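/- **Setup.** A *Steinitz number* is a formal product $e=\prod_p p^{n_p}$ over all primes with $n_p\in\mathbb Z_{\ge 0}\cup\{\infty\}$; divisibility is defined prime by prime, and positive integers are regarded as Steinitz numbers. An element $g$ of a group is *$e$-torsion* if $g^d=1$ for some positive integer $d\mid e$, and a group is $e$-torsion if all its elements are. Let $\mu_e$ be the group of $e$-torsion elements of $\mathbb T=\{z\in\mathbb C:|z|=1\}$, let $\mathbb Z[\mu_e]\subseteq\mathbb C$ be the subring it generates, let $\hat{\mathbb Z}=\varprojlim_n\mathbb Z/n\mathbb Z$ and $e\hat{\mathbb Z}=\bigcap_{d\in\mathbb Z_{>0},\,d\mid e}d\hat{\mathbb Z}$. The ring $\hat{\mathbb Z}/e\hat{\mathbb Z}$ acts on $\mu_e$ by $\zeta\mapsto\zeta^a$, and for $a\in(\hat{\mathbb Z}/e\hat{\mathbb Z})^*$ there is a unique ring automorphism of $\mathbb Z[\mu_e]$ with $\zeta\mapsto\zeta^a$ for all $\zeta\in\mu_e$. Let $k$ be a commutative ring and $R$ a (not necessarily commutative) $k$-algebra on which multiplication by every positive integer dividing $e$ is injective. Put $R'=R\otimes_{\mathbb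 Z}\mathbb Z[\mu_e]$, an algebra over $k'=k\otimes_{\mathbb Z}\mathbb Z[\mu_e]$, and $A=\mathrm{Aut}_{k'\text{-Alg}}(R')$ with the compact-open topology for the discrete topology on $R'$. For $a\in(\hat{\mathbb Z}/e\hat{\mathbb Z})^*$ let $\tau_a$ be the automorphism of $R'$ induced by the automorphism $\zeta\mapsto\zeta^a$ of $\mathbb Z[\mu_e]$. For $\sigma\in A$ and $\zeta\in\mu_e$ let $R'(\sigma,\zeta)=\{x\in R':\sigma(x)=\zeta x\}$; call $\sigma$ *$\mu_e$-diagonalizable* if $\bigoplus_{\zeta\in\mu_e}R'(\sigma,\zeta)\to R'$ is an isomorphism, and then let $\sigma^a$ be the $k'$-linear endomorphism of $R'$ that is multiplication by $\zeta^a$ on $R'(\sigma,\zeta)$ for each $\zeta$. Let $$X_e(R)=\{\sigma\in A:\ \sigma\text{ is }\mu_e\text{-diagonalizable and }\tau_a\sigma\tau_a^{-1}=\sigma^a\text{ for all }a\in(\hat{\mathbb Z}/e\hat{\mathbb Z})^*\}.$$ For a group $\Gamma$, a *$\Gamma$-grading* of $R$ as a $k$-algebra is a family $(R_\gamma)_{\gamma\in\Gamma}$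 of $k$-submodules such that $\bigoplus_\gamma R_\gamma\to R$ is an isomorphism, $1\in R_1$ and $R_\gamma R_\delta\subseteq R_{\gamma\delta}$ for all $\gamma,\delta$; for a homomorphism $f:\Gamma\to\Delta$ let $f_*(R_\gamma)_{\gamma}=\big(\sum_{\gamma\in f^{-1}(\delta)}R_\gamma\big)_{\delta\in\Delta}$. For an abelian group $\Gamma$, equipped with the discrete topology, let $\widehat\Gamma$ be the group of homomorphisms $\Gamma\to\mathbb T$ with the compact-open topology. **Theorem.** Let $\mathbf{Ab}_e$ be the category of abelian $e$-torsion groups. Let $G:\mathbf{Ab}_e\to\mathbf{Set}$ be the functor sending $\Gamma$ to the set of $\Gamma$-gradings of $R$ as a $k$-algebra and a homomorphism $f$ to $f_*$, and let $H:\mathbf{Ab}_e\to\mathbf{Set}$ be the functor sending $\Gamma$ to the set of continuous group homomorphisms $\varphi:\widehat\Gamma\to A$ with $\mathrm{im}(\varphi)\subseteq X_e(R)$ and $f:\Gamma\to\Delta$ to $\varphi\mapsto(\chi\mapsto\varphi(\chi\circ f))$. Then there is a natural isomorphism $\Phi:G\to H$ such that for every abelian $e$-torsion group $\Gamma$: 1.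 $\Phi(\Gamma)$ sends a grading $(R_\gamma)_{\gamma\in\Gamma}$ to the $\varphi$ with $\varphi(\chi)(x\otimes 1)=x\otimes\chi(\gamma)$ for all $\chi\in\widehat\Gamma$, $\gamma\in\Gamma$ and $x\in R_\gamma$; 2. the inverse of $\Phi(\Gamma)$ sends $\varphi$ to the grading with components $R_\gamma=\{x\in R:\ \varphi(\chi)(x\otimes 1)=x\otimes\chi(\gamma)\text{ for all }\chi\in\widehat\Gamma\}$. -/

import Mathlib

open CategoryTheory
open scoped TensorProduct

universe u v w

namespace TorsionGradings

/-! ### Steinitz numbers -/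

/-- Steinitz numbers: formal products `∏ p ^ n_p` over the primes with exponents in `ℕ∞`. -/
def Steinitz : Type := Nat.Primes → ℕ∞

namespace Steinitz

/-- The inclusion of the positive integers in the Steinitz numbers. -/
def ofPNat (d : ℕ+) : Steinitz := fun p => (((d : ℕ).factorization p : ℕ) : ℕ∞)

/-- Divisibility of Steinitz numbers. -/
def Divides (x y : Steinitz) : Prop := ∀ p, x p ≤ y p

lemma divides_one (e : Steinitz) : (ofPNat 1).Divides e := by
  intro p
  simp [ofPNat]

lemma divides_lcm {e : Steinitz} {a b : ℕ+} (ha : (ofPNat a).Divides e)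
    (hb : (ofPNat b).Divides e) : (ofPNat (PNat.lcm a b)).Divides e := by
  intro p
  have h := Nat.factorization_lcm a.ne_zero b.ne_zero
  have h1 := ha p
  have h2 := hb p
  simp only [ofPNat, PNat.lcm_coe, h, Finsupp.sup_apply] at *
  rcases le_total ((a : ℕ).factorization p) ((b : ℕ).factorization p) with hle | hle
  · rwa [sup_of_le_right hle]
  · rwa [sup_of_le_left hle]

end Steinitz

/-- An element `g` of a group is `e`-torsion if `g ^ d = 1` for some positive integer `d` dividing
`e`, i.e. if `g` has finite order and its order divides `e`. -/
def IsETorsion (e : Steinitz) {G : Type*} [Monoid G] (g : G) : Prop :=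
  ∃ d : ℕ+, (Steinitz.ofPNat d).Divides e ∧ g ^ (d : ℕ) = 1

/-! ### Roots of unity and cyclotomic rings -/

/-- The `e`-torsion subgroup `μ_e` of the circle group. -/
def mu (e : Steinitz) : Subgroup Circle where
  carrier := {z | IsETorsion e z}
  one_mem' := ⟨1, e.divides_one, by simp⟩
  mul_mem' := by
    rintro x y ⟨a, ha, hx⟩ ⟨b, hb, hy⟩
    refine ⟨PNat.lcm a b, Steinitz.divides_lcm ha hb, ?_⟩
    obtain ⟨c, hc⟩ : (a : ℕ) ∣ Nat.lcm a b := Nat.dvd_lcm_left _ _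
    obtain ⟨d, hd⟩ : (b : ℕ) ∣ Nat.lcm a b := Nat.dvd_lcm_right _ _
    rw [PNat.lcm_coe, mul_pow]
    nth_rewrite 1 [hc]
    rw [hd, pow_mul, pow_mul, hx, hy, one_pow, one_pow, one_mul]
  inv_mem' := by
    rintro x ⟨a, ha, hx⟩
    exact ⟨a, ha, by rw [inv_pow, hx, inv_one]⟩

/-- The subring `ℤ[μ_e]` of `ℂ`. -/
abbrev Cyc (e : Steinitz) : Subring ℂ :=
  Subring.closure {z : ℂ | ∃ ζ : mu e, ((ζ : Circle) : ℂ) = z}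

/-- The inclusion of `μ_e` in `ℤ[μ_e]`. -/
def root (e : Steinitz) : mu e →* Cyc e where
  toFun ζ := ⟨((ζ : Circle) : ℂ), Subring.subset_closure ⟨ζ, rfl⟩⟩
  map_one' := by ext; simp
  map_mul' x y := by ext; simp

/-! ### Profinite integers -/

/-- The ring of profinite integers, the inverse limit of the rings `ℤ/nℤ`. -/
def ZHat : Subring (∀ n : ℕ+, ZMod n) where
  carrier := {x | ∀ (m n : ℕ+) (h : (m : ℕ) ∣ n), ZMod.castHom h (ZMod m) (x n) = x m}
  one_mem' m n h := map_one _
  mul_mem' {x y} hx hy m n h := by rw [Pi.mul_apply, map_mul, hx, hy]; rfl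
  zero_mem' m n h := map_zero _
  add_mem' {x y} hx hy m n h := by rw [Pi.add_apply, map_add, hx, hy]; rfl
  neg_mem' {x} hx m n h := by rw [Pi.neg_apply, map_neg, hx]; rfl

/-- The ideal `eẐ`, the intersection of the ideals `dẐ` over the positive integers `d` dividing
`e`. -/
def ZHat.ideal (e : Steinitz) : Ideal ZHat :=
  ⨅ (d : ℕ+) (_ : (Steinitz.ofPNat d).Divides e), Ideal.span {((d : ℕ) : ZHat)}

lemma mu.orderOf_pos {e : Steinitz} (ζ : mu e) : 0 < orderOf ζ := by
  obtain ⟨d, -, hd⟩ := ζ.2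
  exact orderOf_pos_iff.mpr (isOfFinOrder_iff_pow_eq_one.mpr ⟨d, d.pos, Subtype.ext hd⟩)

/-- The action `ζ ↦ ζ ^ a` of a profinite integer `a` on `μ_e`: one has `ζ ^ a = ζ ^ n` for
integers `n` congruent to `a` modulo the order of `ζ`. It depends on `a` modulo `eẐ` only. -/
noncomputable def mu.zpow {e : Steinitz} (a : ZHat) (ζ : mu e) : mu e :=
  ζ ^ (a.1 ⟨orderOf ζ, mu.orderOf_pos ζ⟩).val

/-! ### Diagonalizable endomorphisms -/

section Diagonalizable

variable {K N ι : Type*} [CommRing K] [AddCommGroup N] [Module K N]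

open Classical in
/-- `f` is diagonalizable with respect to the family of scalars `c`: the natural map from the direct
sum of the eigenspaces of `f` at the `c i` to the module is an isomorphism. -/
abbrev IsDiag (c : ι → K) (f : Module.End K N) : Prop :=
  Function.Bijective (DirectSum.coeLinearMap fun i => f.eigenspace (c i))

open Classical in
/-- For `f` diagonalizable with respect to `c` and a self-map `g` of the index set, the endomorphism
which is multiplication by `c (g i)` on the eigenspace of `f` at `c i`. -/
noncomputable def diagMap (c : ι → K) (f : Module.End K N) (hf : IsDiag c f) (g : ι → ι) :
    Module.End K N :=
  (DirectSum.toModule K ι N fun i => c (g i) • (f.eigenspace (c i)).subtype) ∘ₗ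
    (LinearEquiv.ofBijective (DirectSum.coeLinearMap fun i => f.eigenspace (c i)) hf).symm

end Diagonalizable

/-! ### The extension `R' = R ⊗ ℤ[μ_e]` and the set `X_e(R)` -/

/-- `R' = R ⊗_ℤ ℤ[μ_e]`. -/
abbrev ExtRing (e : Steinitz) (R : Type*) [Ring R] : Type _ := R ⊗[ℤ] Cyc e

/-- `R'` is an algebra over `k' = k ⊗_ℤ ℤ[μ_e]` through the map induced by `k → R`. -/
noncomputable instance extAlgebra (e : Steinitz) (k : Type*) (R : Type*) [CommRing k] [Ring R]
    [Algebra k R] : Algebra (ExtRing e k) (ExtRing e R) :=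
  RingHom.toAlgebra'
    (Algebra.TensorProduct.map (algebraMap k R).toIntAlgHom (AlgHom.id ℤ (Cyc e))).toRingHom (by
      intro c x
      induction c using TensorProduct.induction_on with
      | zero => simp
      | add c d hc hd => rw [map_add, add_mul, mul_add, hc, hd]
      | tmul c s =>
        induction x using TensorProduct.induction_on with
        | zero => simp
        | add x y hx hy => rw [add_mul, mul_add, hx, hy]
        | tmul r t =>
          change (algebraMap k R c ⊗ₜ[ℤ] s) * (r ⊗ₜ[ℤ] t) = (r ⊗ₜ[ℤ] t) * (algebraMap k R c ⊗ₜ[ℤ] s)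
          rw [Algebra.TensorProduct.tmul_mul_tmul, Algebra.TensorProduct.tmul_mul_tmul,
            Algebra.commutes, mul_comm s t])

/-- The group `A = Aut_{k'-Alg}(R')`. -/
abbrev ExtAut (e : Steinitz) (k : Type*) (R : Type*) [CommRing k] [Ring R] [Algebra k R] : Type _ :=
  ExtRing e R ≃ₐ[ExtRing e k] ExtRing e R

/-- The compact-open topology on `A`, for the discrete topology on `R'`. -/
noncomputable abbrev ExtAut.topology (e : Steinitz) (k : Type*) (R : Type*) [CommRing k] [Ring R] [Algebra k R] :
    TopologicalSpace (ExtAut e k R) :=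
  letI : TopologicalSpace (ExtRing e R) := ⊥
  haveI : DiscreteTopology (ExtRing e R) := ⟨rfl⟩
  TopologicalSpace.induced
    (fun σ => (⟨σ, continuous_of_discreteTopology⟩ : C(ExtRing e R, ExtRing e R))) inferInstance

/-- The elements of `μ_e` as elements of `k'`. -/
noncomputable def rootExt (e : Steinitz) (k : Type*) [CommRing k] (ζ : mu e) : ExtRing e k :=
  1 ⊗ₜ[ℤ] root e ζ

/-- A ring automorphism of `ℤ[μ_e]` acting on `R'` through the second component. -/
noncomputable def extTwist (e : Steinitz) (R : Type*) [Ring R] (τ : Cyc e ≃+* Cyc e) :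
    ExtRing e R ≃+* ExtRing e R :=
  (Algebra.TensorProduct.congr (AlgEquiv.refl : R ≃ₐ[ℤ] R)
    (AlgEquiv.ofRingEquiv (f := τ) fun n => map_intCast τ n)).toRingEquiv

/-- The set `X_e(R)` of the `μ_e`-diagonalizable `σ ∈ A` with `τ_a σ τ_a⁻¹ = σ ^ a` for all
`a ∈ (Ẑ/eẐ)ˣ`. Here `τ_a` is the automorphism of `R'` induced by the ring automorphism of `ℤ[μ_e]`
with `ζ ↦ ζ ^ a` for `ζ ∈ μ_e`, and `σ ^ a` is multiplication by `ζ ^ a` on the eigenspace of `σ`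
at `ζ`. -/
def XSet (e : Steinitz) (k : Type*) (R : Type*) [CommRing k] [Ring R] [Algebra k R] :
    Set (ExtAut e k R) :=
  {σ | ∃ hσ : IsDiag (rootExt e k) σ.toLinearMap,
    ∀ a : ZHat, IsUnit (Ideal.Quotient.mk (ZHat.ideal e) a) →
      ∀ τ : Cyc e ≃+* Cyc e, (∀ ζ : mu e, τ (root e ζ) = root e (mu.zpow a ζ)) →
        ∀ x : ExtRing e R, extTwist e R τ (σ ((extTwist e R τ).symm x)) =
          diagMap (rootExt e k) σ.toLinearMap hσ (mu.zpow a) x}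

/-! ### Gradings -/

open Classical in
/-- The `Γ`-gradings of `R` as a `k`-algebra. -/
@[ext]
structure Grading (k : Type*) (R : Type*) [CommRing k] [Ring R] [Algebra k R]
    (Γ : Type*) [Group Γ] where
  /-- The homogeneous components. -/
  comp : Γ → Submodule k R
  isInternal : DirectSum.IsInternal comp
  one_mem : (1 : R) ∈ comp 1
  mul_mem : ∀ {g h : Γ} {x y : R}, x ∈ comp g → y ∈ comp h → x * y ∈ comp (g * h)

namespace Grading

variable {k : Type*} {R : Type*} [CommRing k] [Ring R] [Algebra k R]
  {Γ Δ : Type*} [Group Γ] [Group Δ]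

/-- The `Δ`-grading `f_* 𝓡`, with components the sums of the `𝓡_γ` over the fibers of `f`. -/
def map (f : Γ →* Δ) (𝓡 : Grading k R Γ) : Grading k R Δ where
  comp δ := ⨆ γ ∈ f ⁻¹' {δ}, 𝓡.comp γ
  isInternal := by
    classical
    have h := (DirectSum.isInternal_submodule_iff_iSupIndep_and_iSup_eq_top _).1 𝓡.isInternal
    refine (DirectSum.isInternal_submodule_iff_iSupIndep_and_iSup_eq_top _).2 ⟨?_, ?_⟩
    · intro δ
      have hd := h.1.disjoint_biSup_biSup (s := f ⁻¹' {δ}) (t := f ⁻¹' {δ}ᶜ)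
        (by rw [Set.preimage_compl]; exact disjoint_compl_right)
      refine hd.mono_right ?_
      refine iSup₂_le fun δ' hδ' => iSup₂_le fun γ hγ => ?_
      refine le_iSup₂_of_le γ ?_ le_rfl
      rw [Set.mem_preimage, Set.mem_singleton_iff] at hγ
      simpa [hγ] using hδ'
    · rw [eq_top_iff, ← h.2]
      exact iSup_le fun γ => le_iSup_of_le (f γ) (le_iSup₂_of_le γ rfl le_rfl)
  one_mem := Submodule.mem_iSup_of_mem 1 (Submodule.mem_iSup_of_mem (map_one f) 𝓡.one_mem)
  mul_mem := by
    intro g h x y hx hy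
    have key : (⨆ γ ∈ f ⁻¹' {g}, 𝓡.comp γ) * (⨆ γ ∈ f ⁻¹' {h}, 𝓡.comp γ) ≤
        ⨆ γ ∈ f ⁻¹' {g * h}, 𝓡.comp γ := by
      simp only [Submodule.iSup_mul, Submodule.mul_iSup]
      refine iSup₂_le fun γ' hγ' => iSup₂_le fun γ hγ => ?_
      refine le_iSup₂_of_le (γ * γ') ?_ (Submodule.mul_le.2 fun a ha b hb => 𝓡.mul_mem ha hb)
      simp only [Set.mem_preimage, Set.mem_singleton_iff] at *
      rw [map_mul, hγ, hγ']
    exact key (Submodule.mul_mem_mul hx hy)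

lemma map_id (𝓡 : Grading k R Γ) : 𝓡.map (MonoidHom.id Γ) = 𝓡 := by
  ext1
  funext γ
  simp [Grading.map]

lemma map_map {Λ : Type*} [Group Λ] (f : Γ →* Δ) (g : Δ →* Λ) (𝓡 : Grading k R Γ) :
    (𝓡.map f).map g = 𝓡.map (g.comp f) := by
  ext1
  funext l
  apply le_antisymm
  · refine iSup₂_le fun δ hδ => iSup₂_le fun γ hγ => le_iSup₂_of_le γ ?_ le_rfl
    simp only [Set.mem_preimage, Set.mem_singleton_iff] at *
    simp [hγ, hδ]
  · exact iSup₂_le fun γ hγ => le_iSup₂_of_le (f γ) hγ (le_iSup₂_of_le γ rfl le_rfl)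

end Grading

/-! ### Abelian `e`-torsion groups, their dual groups, and the two functors -/

/-- The full subcategory of the category of abelian groups on the `e`-torsion groups. -/
abbrev AbTors (e : Steinitz) : Type (w + 1) :=
  ObjectProperty.FullSubcategory fun Γ : CommGrpCat.{w} => ∀ γ : Γ, IsETorsion e γ

/-- The dual group of an abelian group equipped with the discrete topology. -/
abbrev DDual (Γ : Type*) [CommGroup Γ] : Type _ := @PontryaginDual Γ _ ⊥

/-- The morphism `χ ↦ χ ∘ f` of dual groups. -/
noncomputable abbrev DDual.map {Γ Δ : Type*} [CommGroup Γ] [CommGroup Δ] (f : Γ →* Δ) : DDual Δ →ₜ* DDual Γ :=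
  letI : TopologicalSpace Γ := ⊥
  haveI : DiscreteTopology Γ := ⟨rfl⟩
  letI : TopologicalSpace Δ := ⊥
  PontryaginDual.map ⟨f, continuous_of_discreteTopology⟩

/-- The value `χ(γ)`, an element of `μ_e` since `Γ` is `e`-torsion. -/
noncomputable def DDual.eval {e : Steinitz} {Γ : AbTors.{w} e} (χ : DDual Γ.obj) (γ : Γ.obj) : mu e :=
  ⟨χ γ, by
    obtain ⟨d, hd, h⟩ := Γ.property γ
    exact ⟨d, hd, by rw [← map_pow, h, map_one]⟩⟩

/-- The continuous group homomorphisms `φ : Γ^ → A` with image contained in `X_e(R)`. -/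
@[ext]
structure DualHom (e : Steinitz) (k : Type*) (R : Type*) [CommRing k] [Ring R] [Algebra k R]
    (Γ : Type*) [CommGroup Γ] where
  toHom : DDual Γ →* ExtAut e k R
  continuous_toHom : @Continuous _ _ _ (ExtAut.topology e k R) toHom
  range_subset : Set.range toHom ⊆ XSet e k R

/-- Precomposition with the dual of `f`. -/
noncomputable def DualHom.map {e : Steinitz} {k : Type*} {R : Type*} [CommRing k] [Ring R]
    [Algebra k R] {Γ Δ : Type*} [CommGroup Γ] [CommGroup Δ] (f : Γ →* Δ) (φ : DualHom e k R Γ) :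
    DualHom e k R Δ where
  toHom := φ.toHom.comp (DDual.map f).toMonoidHom
  continuous_toHom := by
    let := ExtAut.topology e k R
    exact φ.continuous_toHom.comp (DDual.map f).continuous_toFun
  range_subset := by
    rintro _ ⟨χ, rfl⟩
    exact φ.range_subset ⟨DDual.map f χ, rfl⟩

/-- The functor sending `Γ` to the set of `Γ`-gradings of `R` as a `k`-algebra, and a morphism `f`
to `f_*`. -/
def gradingFunctor (e : Steinitz) (k : Type u) (R : Type v) [CommRing k] [Ring R] [Algebra k R] :
    AbTors.{w} e ⥤ Type (max v w) where
  obj Γ := Grading k R Γ.obj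
  map f := TypeCat.ofHom (Grading.map f.hom.hom)
  map_id Γ := by
    refine ConcreteCategory.hom_ext _ _ fun 𝓡 => ?_
    exact Grading.map_id 𝓡
  map_comp f g := by
    refine ConcreteCategory.hom_ext _ _ fun 𝓡 => ?_
    exact (Grading.map_map f.hom.hom g.hom.hom 𝓡).symm

/-- The functor sending `Γ` to the set of continuous homomorphisms `Γ^ → A` with image in `X_e(R)`,
and a morphism `f` to precomposition with the dual of `f`. -/
noncomputable def dualHomFunctor (e : Steinitz) (k : Type u) (R : Type v) [CommRing k] [Ring R]
    [Algebra k R] : AbTors.{w} e ⥤ Type (max v w) where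
  obj Γ := DualHom e k R Γ.obj
  map f := TypeCat.ofHom (DualHom.map f.hom.hom)
  map_id Γ := by
    ext φ
    rfl
  map_comp f g := by
    ext φ
    rfl

end TorsionGradings

open TorsionGradings

namespace TorsionGradings

/-! ### The cyclotomic rings -/

section Cyc

variable (e : Steinitz)

/-! A grading gives automorphisms of `R'`: let `χ` scale `R_γ ⊗ ℤ[μ_e]` by `χ(γ)`.
Diagonalizability, the twisting relation and continuity can all be checked on the elements `x ⊗ s`
with `x` homogeneous (`scaleAut_mem_XSet`, `Grading.toDualHom`).

For the converse, let `φ` be given. Two distinct elements of `μ_e` have a difference dividing some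
integer `d ∣ e` in `ℤ[μ_e]`. Multiplication by `d` is injective on `R'` by flatness, so eigenspaces
for distinct roots of unity are independent. The stabilizer of `y ∈ R'` is open in the compact dual
of `Γ`, hence of finite index. So finitely many commuting diagonalizable automorphisms split `y`
into joint eigenvectors of the whole dual (`DualHom.iSup_extComp`). The eigenvalues of a nonzero
joint eigenvector form a character of the dual with open kernel, and such a character is evaluation
at some `γ` (`DDual.exists_eq_eval`). Thus `R'` is the direct sum of its parts of degree `γ`.

It remains to descend from `R'` to `R`. The relation `τ_a σ τ_a⁻¹ = σ ^ a` makes each part stable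
under the Galois group (`DualHom.extTwist_mem_extComp`), so the components of the invariant element
`x ⊗ 1` are invariant. Invariant elements come from `R` (`exists_eq_tmul_one`), by a trace argument
combined with faithful flatness of `ℤ[μ_e]` over `ℤ`. Only those `a` that are values of the
cyclotomic character are needed here. -/

instance Cyc.isIntegral : Algebra.IsIntegral ℤ (Cyc e) := by
  refine ⟨fun x => ?_⟩
  rw [← isIntegral_algHom_iff (Cyc e).subtype.toIntAlgHom Subtype.val_injective]
  change IsIntegral ℤ (x : ℂ)
  refine Subring.closure_induction (p := fun z _ => IsIntegral ℤ z) ?_ isIntegral_zero isIntegral_one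
    (fun _ _ _ _ => IsIntegral.add) (fun _ _ => IsIntegral.neg) (fun _ _ _ _ => IsIntegral.mul) x.2
  rintro _ ⟨ζ, rfl⟩
  obtain ⟨d, -, hd⟩ := ζ.2
  refine IsIntegral.of_pow d.pos ?_
  rw [← Circle.coe_pow, hd, Circle.coe_one]
  exact isIntegral_one

/-- An integral extension domain of `ℤ` is torsion-free, hence flat, and every prime of `ℤ` has a
prime above it. -/
instance Cyc.faithfullyFlat : Module.FaithfullyFlat ℤ (Cyc e) :=
  Module.FaithfullyFlat.of_isIntegral_of_isDomain

lemma root_injective : Function.Injective (root e) := by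
  intro x y h
  have h' : ((x : Circle) : ℂ) = ((y : Circle) : ℂ) :=
    congrArg (Subtype.val : Cyc e → ℂ) h
  exact Subtype.ext (Circle.ext h')

variable {e} in
/-- Differences of distinct elements of `μ_e` divide a positive integer dividing `e`. -/
lemma exists_root_sub_root_mul_eq {ζ η : mu e} (h : ζ ≠ η) :
    ∃ d : ℕ+, (Steinitz.ofPNat d).Divides e ∧ ∃ b : Cyc e, b * (root e ζ - root e η) = (d : ℕ) := by
  set ξ : mu e := η * ζ⁻¹ with hξ
  have hξ1 : root e ξ ≠ 1 := by
    rw [← map_one (root e)]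
    intro h'
    exact h (mul_inv_eq_one.1 (root_injective e h')).symm
  obtain ⟨d, hd, hpow⟩ := ξ.2
  have hpow' : root e ξ ^ (d : ℕ) = 1 := by
    rw [← map_pow, ← map_one (root e)]
    exact congrArg _ (Subtype.ext hpow)
  -- `ξ ≠ 1` is a `d`-th root of unity in a domain, so its geometric sum vanishes. Hence `d` is the
  -- sum of the `1 - ξ ^ j`, each divisible by `1 - ξ`.
  have hsum : ∑ j ∈ Finset.range d, root e ξ ^ j = 0 := by
    have := mul_geom_sum (root e ξ) d
    rw [hpow', sub_self] at this
    exact (mul_eq_zero.1 this).resolve_left (sub_ne_zero.2 hξ1)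
  have hdvd : (1 - root e ξ) ∣ ((d : ℕ) : Cyc e) := by
    have : ((d : ℕ) : Cyc e) = ∑ j ∈ Finset.range d, (1 - root e ξ ^ j) := by
      rw [Finset.sum_sub_distrib, hsum]
      simp
    rw [this]
    refine Finset.dvd_sum fun j _ => ?_
    simpa using sub_dvd_pow_sub_pow 1 (root e ξ) j
  obtain ⟨b, hb⟩ := hdvd
  -- The factor `ζ⁻¹` turns `ζ - η` into `1 - ξ`.
  refine ⟨d, hd, b * root e ζ⁻¹, ?_⟩
  have h1 : root e ζ⁻¹ * root e ζ = 1 := by rw [← map_mul, inv_mul_cancel, map_one]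
  rw [hb, hξ, map_mul]
  linear_combination b * h1

end Cyc

/-! ### The extension `R'` -/

section Ext

variable (e : Steinitz) {k : Type*} {R : Type*} [CommRing k] [Ring R] [Algebra k R]

lemma tmul_one_injective (M : Type*) [AddCommGroup M] :
    Function.Injective fun x : M => x ⊗ₜ[ℤ] (1 : Cyc e) := by
  intro x y h
  refine Module.FaithfullyFlat.tensorProduct_mk_injective (A := ℤ) (B := Cyc e) M ?_
  simpa using congrArg (TensorProduct.comm ℤ M (Cyc e)) h

/-- Flatness carries the hypothesis on `R` over to `R'`. -/
lemma nsmul_ext_injective {d : ℕ} (hd : Function.Injective fun x : R => d • x) :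
    Function.Injective fun y : ExtRing e R => d • y := by
  have h := Module.Flat.rTensor_preserves_injective_linearMap (M := Cyc e)
    ((d : ℤ) • (LinearMap.id : R →ₗ[ℤ] R)) (by
      intro x y hxy
      simp only [LinearMap.smul_apply, LinearMap.id_apply, natCast_zsmul] at hxy
      exact hd hxy)
  rw [LinearMap.rTensor_smul, LinearMap.rTensor_id] at h
  intro x y hxy
  refine h ?_
  simp only [LinearMap.smul_apply, LinearMap.id_apply, natCast_zsmul]
  exact hxy

/-- The elements of `μ_e` as elements of `R'`. -/
noncomputable abbrev rootR (R : Type*) [Ring R] (ζ : mu e) : ExtRing e R := 1 ⊗ₜ[ℤ] root e ζ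

lemma tmul_smul_tmul (a : k) (s : Cyc e) (x : R) (t : Cyc e) :
    (a ⊗ₜ[ℤ] s : ExtRing e k) • (x ⊗ₜ[ℤ] t : ExtRing e R) = (a • x) ⊗ₜ[ℤ] (s * t) := by
  rw [Algebra.smul_def, Algebra.smul_def]
  exact Algebra.TensorProduct.tmul_mul_tmul _ _ _ _

lemma rootExt_smul (ζ : mu e) (y : ExtRing e R) : rootExt e k ζ • y = rootR e R ζ * y := by
  rw [Algebra.smul_def]
  change (algebraMap k R 1 ⊗ₜ[ℤ] root e ζ) * y = _
  rw [map_one]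

lemma rootR_mul_tmul (ζ : mu e) (x : R) (t : Cyc e) :
    rootR e R ζ * (x ⊗ₜ[ℤ] t) = x ⊗ₜ[ℤ] (root e ζ * t) := by
  rw [Algebra.TensorProduct.tmul_mul_tmul, one_mul]

lemma rootR_mul_tmul_one (ζ : mu e) (x : R) :
    rootR e R ζ * (x ⊗ₜ[ℤ] 1) = x ⊗ₜ[ℤ] root e ζ := by
  rw [rootR_mul_tmul, mul_one]

lemma rootR_mul (ζ η : mu e) : rootR e R (ζ * η) = rootR e R ζ * rootR e R η := by
  rw [rootR_mul_tmul, rootR, map_mul]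

lemma rootR_one : rootR e R 1 = 1 := by
  rw [rootR, map_one, Algebra.TensorProduct.one_def]

lemma one_tmul_comm (s : Cyc e) (y : ExtRing e R) : (1 ⊗ₜ[ℤ] s) * y = y * (1 ⊗ₜ[ℤ] s) := by
  induction y using TensorProduct.induction_on with
  | zero => rw [mul_zero, zero_mul]
  | add x y hx hy => rw [mul_add, add_mul, hx, hy]
  | tmul x t =>
    rw [Algebra.TensorProduct.tmul_mul_tmul, Algebra.TensorProduct.tmul_mul_tmul, one_mul, mul_one,
      mul_comm]

variable {e}

/-- Distinct elements of `μ_e` act differently on every nonzero element of `R'`. -/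
lemma eq_zero_of_rootR_mul_eq
    (hR : ∀ d : ℕ+, (Steinitz.ofPNat d).Divides e → Function.Injective fun x : R => (d : ℕ) • x)
    {ζ η : mu e} (h : ζ ≠ η) {y : ExtRing e R} (hy : rootR e R ζ * y = rootR e R η * y) :
    y = 0 := by
  obtain ⟨d, hd, b, hb⟩ := exists_root_sub_root_mul_eq h
  refine nsmul_ext_injective e (hR d hd) ?_
  have h0 : (rootR e R ζ - rootR e R η) * y = 0 := by rw [sub_mul, hy, sub_self]
  have h1 : (1 ⊗ₜ[ℤ] b) * (rootR e R ζ - rootR e R η) = (d : ℕ) • (1 : ExtRing e R) := by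
    rw [rootR, rootR, ← TensorProduct.tmul_sub, Algebra.TensorProduct.tmul_mul_tmul, hb, one_mul,
      ← nsmul_one, TensorProduct.tmul_smul, Algebra.TensorProduct.one_def]
  calc (d : ℕ) • y = ((d : ℕ) • (1 : ExtRing e R)) * y := by rw [smul_mul_assoc, one_mul]
    _ = 0 := by rw [← h1, mul_assoc, h0, mul_zero]
    _ = (d : ℕ) • (0 : ExtRing e R) := (smul_zero _).symm

lemma extTwist_tmul (τ : Cyc e ≃+* Cyc e) (x : R) (s : Cyc e) :
    extTwist e R τ (x ⊗ₜ[ℤ] s) = x ⊗ₜ[ℤ] τ s := rfl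

lemma extTwist_symm_tmul (τ : Cyc e ≃+* Cyc e) (x : R) (s : Cyc e) :
    (extTwist e R τ).symm (x ⊗ₜ[ℤ] s) = x ⊗ₜ[ℤ] τ.symm s := rfl

lemma extTwist_rootR (τ : Cyc e ≃+* Cyc e) {ζ η : mu e} (h : τ (root e ζ) = root e η) :
    extTwist e R τ (rootR e R ζ) = rootR e R η := by
  rw [rootR, extTwist_tmul, h]

end Ext

/-! ### Diagonalizable endomorphisms -/

lemma exists_sum_of_iSup_eq_top {K N ι : Type*} [Ring K] [AddCommGroup N] [Module K N]
    {p : ι → Submodule K N} (hp : iSup p = ⊤) (x : N) :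
    ∃ (s : Finset ι) (v : ι → N), (∀ i, v i ∈ p i) ∧ x = ∑ i ∈ s, v i := by
  obtain ⟨v, hv, rfl⟩ := (Submodule.mem_iSup_iff_exists_finsupp p x).1 (hp ▸ Submodule.mem_top)
  exact ⟨v.support, v, hv, rfl⟩

section Diag

variable {K N ι : Type*} [CommRing K] [AddCommGroup N] [Module K N] {c : ι → K} {f : Module.End K N}

open Classical in
lemma isDiag_iff : IsDiag c f ↔
    iSupIndep (fun i => f.eigenspace (c i)) ∧ ⨆ i, f.eigenspace (c i) = ⊤ :=
  DirectSum.isInternal_submodule_iff_iSupIndep_and_iSup_eq_top fun i => f.eigenspace (c i)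

lemma diagMap_apply_of_mem (hf : IsDiag c f) (g : ι → ι) {i : ι} {x : N}
    (hx : x ∈ f.eigenspace (c i)) : diagMap c f hf g x = c (g i) • x := by
  classical
  have : (LinearEquiv.ofBijective (DirectSum.coeLinearMap fun i => f.eigenspace (c i)) hf).symm x =
      DirectSum.lof K ι (fun i => f.eigenspace (c i)) i ⟨x, hx⟩ := by
    rw [LinearEquiv.symm_apply_eq, LinearEquiv.ofBijective_apply]
    simp
  rw [diagMap, LinearMap.comp_apply, LinearEquiv.coe_coe, this]
  simp

/-- Joint eigenspaces are independent if any two of the systems of eigenvalues contain scalars that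
act differently on all nonzero vectors. -/
lemma iSupIndep_iInf_eigenspace {α : Type*} {f : α → Module.End K N} {c : α → ι → K}
    (hc : ∀ i j, i ≠ j → ∃ a, ∀ y : N, c a i • y = c a j • y → y = 0) :
    iSupIndep fun i => ⨅ a, (f a).eigenspace (c a i) := by
  classical
  rw [iSupIndep_iff_finsetSum_eq_zero_imp_eq_zero]
  intro s
  induction s using Finset.induction_on with
  | empty => simp
  | insert j s hj ih =>
    intro v hv hsum
    have hs : ∀ i ∈ s, v i = 0 := by
      intro i hi
      obtain ⟨a, ha⟩ := hc i j (fun h => hj (h ▸ hi))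
      -- Applying `f a - c a j` to the relation kills its `j`-th term and multiplies the others by
      -- `c a i - c a j`, which leaves a shorter relation.
      have key := ih (fun i => (c a i - c a j) • v i)
        (fun i hi => Submodule.smul_mem _ _ (hv i (Finset.mem_insert_of_mem hi))) (by
          have h1 : f a (∑ i ∈ insert j s, v i) - c a j • ∑ i ∈ insert j s, v i =
              ∑ i ∈ insert j s, (c a i - c a j) • v i := by
            rw [map_sum, Finset.smul_sum, ← Finset.sum_sub_distrib]
            refine Finset.sum_congr rfl fun i hi => ?_
            rw [Module.End.mem_eigenspace_iff.1 ((Submodule.mem_iInf _).1 (hv i hi) a), sub_smul]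
          rw [hsum, map_zero, smul_zero, sub_zero, Finset.sum_insert hj, sub_self, zero_smul,
            zero_add] at h1
          exact h1.symm)
      refine ha _ ?_
      rw [← sub_eq_zero, ← sub_smul]
      exact key i hi
    rw [Finset.sum_insert hj, Finset.sum_eq_zero hs, add_zero] at hsum
    intro i hi
    rcases Finset.mem_insert.1 hi with rfl | hi
    · exact hsum
    · exact hs i hi

/-- Eigenspaces at scalars that act differently on all nonzero vectors are independent. -/
lemma iSupIndep_eigenspace (hc : ∀ i j, i ≠ j → ∀ y : N, c i • y = c j • y → y = 0) :
    iSupIndep fun i => f.eigenspace (c i) := by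
  have h := iSupIndep_iInf_eigenspace (f := fun _ : Unit => f) (c := fun _ => c)
    fun i j hij => ⟨(), hc i j hij⟩
  simpa using h

/-- Writing `x` as a sum of eigenvectors `v j`, the hypothesis becomes a relation between the `(c (g
j) - c (g i)) • v j`. By independence each term is zero, and injectivity of `g` then forces `v j =
0` for `j ≠ i`. This is how an eigenvector of `σ ^ a` is recognized as one of `σ`. -/
lemma mem_eigenspace_of_diagMap_apply_eq (hf : IsDiag c f) {g : ι → ι} (hg : Function.Injective g)
    (hc : ∀ i j, i ≠ j → ∀ y : N, c i • y = c j • y → y = 0) {i : ι} {x : N}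
    (hx : diagMap c f hf g x = c (g i) • x) : x ∈ f.eigenspace (c i) := by
  obtain ⟨hind, htop⟩ := isDiag_iff.1 hf
  obtain ⟨s, v, hv, rfl⟩ := exists_sum_of_iSup_eq_top htop x
  rw [iSupIndep_iff_finsetSum_eq_zero_imp_eq_zero] at hind
  have key := hind s (fun j => (c (g j) - c (g i)) • v j) (fun j _ => Submodule.smul_mem _ _ (hv j))
    (by
      rw [map_sum, Finset.smul_sum, ← sub_eq_zero, ← Finset.sum_sub_distrib] at hx
      rw [← hx]
      refine Finset.sum_congr rfl fun j _ => ?_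
      rw [diagMap_apply_of_mem hf g (hv j), sub_smul])
  refine Submodule.sum_mem _ fun j hj => ?_
  by_cases hji : j = i
  · exact hji ▸ hv j
  · have := hc (g j) (g i) (fun h => hji (hg h)) (v j) (by
      rw [← sub_eq_zero, ← sub_smul]
      exact key j hj)
    rw [this]
    exact Submodule.zero_mem _

/-- A vector is a sum of eigenvectors that are eigenvectors of all commuting endomorphisms which have
the vector as an eigenvector. -/
lemma IsDiag.exists_sum_eigenvectors (hf : IsDiag c f) (x : N) :
    ∃ (s : Finset ι) (v : ι → N), (∀ i ∈ s, f (v i) = c i • v i) ∧ x = ∑ i ∈ s, v i ∧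
      ∀ (h : Module.End K N) (a : K), Commute h f → h x = a • x → ∀ i ∈ s, h (v i) = a • v i := by
  obtain ⟨hind, htop⟩ := isDiag_iff.1 hf
  obtain ⟨s, v, hv, rfl⟩ := exists_sum_of_iSup_eq_top htop x
  refine ⟨s, v, fun i _ => Module.End.mem_eigenspace_iff.1 (hv i), rfl, fun h a hcomm hx i hi => ?_⟩
  rw [iSupIndep_iff_finsetSum_eq_zero_imp_eq_zero] at hind
  -- Since `h` preserves the eigenspaces of `f`, the vectors `h (v j) - a • v j` lie in independent
  -- submodules, and they sum to `h x - a • x = 0`.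
  refine sub_eq_zero.1 (hind s (fun j => h (v j) - a • v j) (fun j _ => ?_) ?_ i hi)
  · refine Submodule.sub_mem _ ?_ (Submodule.smul_mem _ _ (hv j))
    rw [Module.End.mem_eigenspace_iff, ← Module.End.mul_apply, ← hcomm.eq, Module.End.mul_apply,
      Module.End.mem_eigenspace_iff.1 (hv j), map_smul]
  · rw [Finset.sum_sub_distrib, ← map_sum, hx, Finset.smul_sum, sub_self]

end Diag

/-! ### Galois automorphisms of the cyclotomic rings -/

section Galois

/-- The field of algebraic numbers. -/
noncomputable abbrev AlgNum : IntermediateField ℚ ℂ := algebraicClosure ℚ ℂ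

instance AlgNum.isAlgClosure : IsAlgClosure ℚ AlgNum := algebraicClosure.isAlgClosure ℚ ℂ

instance AlgNum.isAlgClosed : IsAlgClosed AlgNum := IsAlgClosure.isAlgClosed ℚ

instance AlgNum.normal : Normal ℚ AlgNum := IsAlgClosure.normal ℚ AlgNum

/-- The group of Galois automorphisms of the algebraic numbers. -/
abbrev AbsGal : Type := AlgNum ≃ₐ[ℚ] AlgNum

/-- The cyclotomic character of the absolute Galois group modulo `n`. -/
noncomputable def cycChar (n : ℕ+) : AbsGal →* (ZMod n)ˣ :=
  (modularCyclotomicCharacter AlgNum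
    (HasEnoughRootsOfUnity.natCard_rootsOfUnity AlgNum (n : ℕ))).comp
    { toFun := fun g => (g : AlgNum ≃+* AlgNum)
      map_one' := rfl
      map_mul' := fun _ _ => rfl }

lemma apply_eq_pow_cycChar (g : AbsGal) {n : ℕ+} {t : AlgNum} (ht : t ^ (n : ℕ) = 1) :
    g t = t ^ (cycChar n g : ZMod n).val :=
  modularCyclotomicCharacter.spec AlgNum
    (HasEnoughRootsOfUnity.natCard_rootsOfUnity AlgNum (n : ℕ)) (g : AlgNum ≃+* AlgNum)
    (t := (rootsOfUnity.mkOfPowEq t ht : AlgNumˣ)) (rootsOfUnity.mkOfPowEq t ht).2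

/-- An `m`-th root of unity is also an `n`-th one, so the reduction of the character modulo `n`
satisfies the property that characterizes the one modulo `m`. This compatibility makes the family a
profinite integer. -/
lemma castHom_cycChar (g : AbsGal) {m n : ℕ+} (h : (m : ℕ) ∣ n) :
    ZMod.castHom h (ZMod m) (cycChar n g : ZMod n) = (cycChar m g : ZMod m) := by
  refine modularCyclotomicCharacter.unique AlgNum
    (HasEnoughRootsOfUnity.natCard_rootsOfUnity AlgNum (m : ℕ)) (g : AlgNum ≃+* AlgNum) ?_
  intro t ht
  have htm : (t : AlgNum) ^ (m : ℕ) = 1 := (mem_rootsOfUnity' _ _).1 ht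
  have htn : (t : AlgNum) ^ (n : ℕ) = 1 := by
    obtain ⟨l, hl⟩ := h
    rw [hl, pow_mul, htm, one_pow]
  refine (apply_eq_pow_cycChar g htn).trans ?_
  rw [ZMod.castHom_apply, ← ZMod.natCast_val, ZMod.val_natCast]
  exact pow_eq_pow_mod _ htm

/-- The cyclotomic character of the absolute Galois group. -/
noncomputable def cycCharHat : AbsGal →* ZHat where
  toFun g := ⟨fun n => (cycChar n g : ZMod n), fun _ _ h => castHom_cycChar g h⟩
  map_one' := by
    ext n
    simp
  map_mul' g h := by
    ext n
    simp

variable (e : Steinitz)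

/-- The inclusion of `ℤ[μ_e]` in the field of algebraic numbers. -/
noncomputable def cycIncl : Cyc e →+* AlgNum where
  toFun x := ⟨x, (mem_algebraicClosure_iff').2
    (((Algebra.IsIntegral.isIntegral (R := ℤ) x).map (Cyc e).subtype.toIntAlgHom).tower_top)⟩
  map_one' := rfl
  map_mul' _ _ := rfl
  map_zero' := rfl
  map_add' _ _ := rfl

lemma cycIncl_injective : Function.Injective (cycIncl e) := by
  intro x y h
  exact Subtype.ext (congrArg (Subtype.val : AlgNum → ℂ) h)

variable {e}

lemma cycIncl_root_pow {ζ : mu e} {n : ℕ} (h : ζ ^ n = 1) : cycIncl e (root e ζ) ^ n = 1 := by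
  rw [← map_pow, ← map_pow, h, map_one, map_one]

lemma apply_cycIncl_root (g : AbsGal) (ζ : mu e) :
    g (cycIncl e (root e ζ)) = cycIncl e (root e (mu.zpow (cycCharHat g) ζ)) := by
  rw [apply_eq_pow_cycChar g (n := ⟨orderOf ζ, mu.orderOf_pos ζ⟩)
    (cycIncl_root_pow (pow_orderOf_eq_one ζ)), ← map_pow, ← map_pow]
  rfl

/-- Galois automorphisms map the generating roots of unity to roots of unity in `μ_e`, so they
preserve the subring generated. -/
lemma exists_cycIncl_eq (g : AbsGal) (x : Cyc e) : ∃ y : Cyc e, cycIncl e y = g (cycIncl e x) := by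
  obtain ⟨x, hx⟩ := x
  refine Subring.closure_induction
    (p := fun z hz => ∃ y : Cyc e, cycIncl e y = g (cycIncl e ⟨z, hz⟩)) ?_ ?_ ?_ ?_ ?_ ?_ hx
  · rintro _ ⟨ζ, rfl⟩
    exact ⟨_, (apply_cycIncl_root g ζ).symm⟩
  · exact ⟨0, by rw [map_zero]; exact (map_zero (g.toRingHom.comp (cycIncl e))).symm⟩
  · exact ⟨1, by rw [map_one]; exact (map_one (g.toRingHom.comp (cycIncl e))).symm⟩
  · rintro x y hx hy ⟨a, ha⟩ ⟨b, hb⟩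
    exact ⟨a + b, by
      rw [map_add, ha, hb]; exact (map_add (g.toRingHom.comp (cycIncl e)) ⟨x, hx⟩ ⟨y, hy⟩).symm⟩
  · rintro x hx ⟨a, ha⟩
    exact ⟨-a, by rw [map_neg, ha]; exact (map_neg (g.toRingHom.comp (cycIncl e)) ⟨x, hx⟩).symm⟩
  · rintro x y hx hy ⟨a, ha⟩ ⟨b, hb⟩
    exact ⟨a * b, by
      rw [map_mul, ha, hb]; exact (map_mul (g.toRingHom.comp (cycIncl e)) ⟨x, hx⟩ ⟨y, hy⟩).symm⟩

variable (e) in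
/-- The action of the absolute Galois group on `ℤ[μ_e]`. -/
noncomputable def cycGal (g : AbsGal) : Cyc e ≃+* Cyc e where
  toFun x := (exists_cycIncl_eq g x).choose
  invFun x := (exists_cycIncl_eq g⁻¹ x).choose
  left_inv x := by
    refine cycIncl_injective e ?_
    rw [(exists_cycIncl_eq g⁻¹ _).choose_spec, (exists_cycIncl_eq g _).choose_spec]
    exact g.symm_apply_apply _
  right_inv x := by
    refine cycIncl_injective e ?_
    rw [(exists_cycIncl_eq g _).choose_spec, (exists_cycIncl_eq g⁻¹ _).choose_spec]
    exact g.apply_symm_apply _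
  map_mul' x y := by
    refine cycIncl_injective e ?_
    rw [(exists_cycIncl_eq g (x * y)).choose_spec, map_mul, map_mul, map_mul,
      (exists_cycIncl_eq g x).choose_spec, (exists_cycIncl_eq g y).choose_spec]
  map_add' x y := by
    refine cycIncl_injective e ?_
    rw [(exists_cycIncl_eq g (x + y)).choose_spec, map_add, map_add, map_add,
      (exists_cycIncl_eq g x).choose_spec, (exists_cycIncl_eq g y).choose_spec]

lemma cycIncl_cycGal (g : AbsGal) (x : Cyc e) : cycIncl e (cycGal e g x) = g (cycIncl e x) :=
  (exists_cycIncl_eq g x).choose_spec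

lemma cycGal_root (g : AbsGal) (ζ : mu e) :
    cycGal e g (root e ζ) = root e (mu.zpow (cycCharHat g) ζ) :=
  cycIncl_injective e ((cycIncl_cycGal g _).trans (apply_cycIncl_root g ζ))

/-- The image of a group under a monoid homomorphism consists of units, so the defining condition of
`XSet` may be applied with `a = cycCharHat g`. -/
lemma isUnit_mk_cycCharHat (g : AbsGal) :
    IsUnit (Ideal.Quotient.mk (ZHat.ideal e) (cycCharHat g)) := by
  refine IsUnit.map (Ideal.Quotient.mk (ZHat.ideal e)) ?_
  exact (Group.isUnit g).map cycCharHat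

end Galois

/-! ### Descent from `R'` to `R` -/

section Descent

/-- The `n`-th cyclotomic field, as a subfield of the algebraic numbers. -/
noncomputable def cycField (n : ℕ) : IntermediateField ℚ AlgNum :=
  IntermediateField.adjoin ℚ {z | z ^ n = 1}

lemma cycField_mono {m n : ℕ} (h : m ∣ n) : cycField m ≤ cycField n := by
  refine IntermediateField.adjoin.mono _ _ _ fun z hz => ?_
  obtain ⟨l, rfl⟩ := h
  rw [Set.mem_ofPred_eq] at *
  rw [pow_mul, hz, one_pow]

instance cycField.normal (n : ℕ) : Normal ℚ (cycField n) := by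
  -- Two `ℚ`-algebra structures on the subfield are in play; they agree because a ring carries at
  -- most one.
  suffices h : @Normal ℚ (cycField n) _ _ (cycField n).algebra' by
    convert h
    exact Subsingleton.elim _ _
  rw [IntermediateField.normal_iff_forall_map_le]
  intro σ
  rw [cycField, IntermediateField.adjoin_map]
  refine IntermediateField.adjoin.mono _ _ _ ?_
  rintro _ ⟨z, hz, rfl⟩
  rw [Set.mem_ofPred_eq] at *
  rw [← map_pow, hz, map_one]

instance cycField.finiteDimensional (n : ℕ) [NeZero n] : FiniteDimensional ℚ (cycField n) := by
  have hfin : {z : AlgNum | z ^ n = 1}.Finite := by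
    refine (Polynomial.nthRootsFinset n (1 : AlgNum)).finite_toSet.subset fun z hz => ?_
    exact (Polynomial.mem_nthRootsFinset (NeZero.pos n) 1).2 hz
  have : Finite {z : AlgNum | z ^ n = 1} := hfin
  exact IntermediateField.finiteDimensional_adjoin fun z _ => Algebra.IsIntegral.isIntegral z

instance cycField.isGalois (n : ℕ) : IsGalois ℚ (cycField n) where

/-- An automorphism of the algebraic numbers extending one of the `n`-th cyclotomic field. -/
noncomputable def liftGal {n : ℕ} (σ : cycField n ≃ₐ[ℚ] cycField n) : AbsGal :=
  (AlgEquiv.restrictNormalHom_surjective (F := ℚ) (K₁ := cycField n) AlgNum σ).choose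

lemma liftGal_apply {n : ℕ} (σ : cycField n ≃ₐ[ℚ] cycField n) (x : cycField n) :
    liftGal σ x = σ x := by
  have h := (AlgEquiv.restrictNormalHom_surjective (F := ℚ) (K₁ := cycField n) AlgNum σ).choose_spec
  have h' := AlgEquiv.restrictNormal_commutes (liftGal σ) (cycField n) x
  exact h'.symm.trans (congrArg (fun τ : cycField n ≃ₐ[ℚ] cycField n => ((τ x : cycField n) : AlgNum)) h)

lemma eq_one_of_liftGal_apply {n : ℕ} [NeZero n] {ζ : AlgNum} (hζ : IsPrimitiveRoot ζ n)
    {σ : cycField n ≃ₐ[ℚ] cycField n} (h : liftGal σ ζ = ζ) : σ = 1 := by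
  have key : ∀ x ∈ cycField n, liftGal σ x = x := by
    intro x hx
    induction hx using IntermediateField.adjoin_induction with
    | mem x hx =>
      obtain ⟨i, -, rfl⟩ := hζ.eq_pow_of_pow_eq_one hx
      rw [map_pow, h]
    | algebraMap x => exact (liftGal σ).commutes x
    | add x y _ _ hx hy => rw [map_add, hx, hy]
    | inv x _ hx => rw [map_inv₀, hx]
    | mul x y _ _ hx hy => rw [map_mul, hx, hy]
  ext x
  have := liftGal_apply σ x
  rw [key _ x.2] at this
  exact congrArg _ this.symm

variable {e : Steinitz} {R : Type*} [Ring R]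

variable (e) in
/-- The trace of the `n`-th cyclotomic field, extended to `ℤ[μ_e]`. -/
noncomputable def cycTrace (n : ℕ) [NeZero n] (b : Cyc e) : Cyc e :=
  ∑ σ : cycField n ≃ₐ[ℚ] cycField n, cycGal e (liftGal σ) b

/-- The trace is a rational number that is integral over `ℤ`. -/
lemma exists_cycTrace_eq {n : ℕ} [NeZero n] {b : Cyc e} (hb : cycIncl e b ∈ cycField n) :
    ∃ m : ℤ, cycTrace e n b = m := by
  obtain ⟨q, hq⟩ : ∃ q : ℚ, algebraMap ℚ AlgNum q = cycIncl e (cycTrace e n b) := by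
    refine ⟨Algebra.trace ℚ (cycField n) ⟨_, hb⟩, ?_⟩
    rw [IsScalarTower.algebraMap_apply ℚ (cycField n) AlgNum, trace_eq_sum_automorphisms, map_sum,
      cycTrace, map_sum]
    refine Finset.sum_congr rfl fun σ _ => ?_
    rw [cycIncl_cycGal]
    exact (liftGal_apply σ ⟨_, hb⟩).symm
  have hint : IsIntegral ℤ q := by
    rw [← isIntegral_algebraMap_iff (B := AlgNum) (algebraMap ℚ AlgNum).injective, hq]
    exact (Algebra.IsIntegral.isIntegral (R := ℤ) (cycTrace e n b)).map (cycIncl e).toIntAlgHom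
  obtain ⟨m, rfl⟩ := IsIntegrallyClosed.isIntegral_iff.1 hint
  refine ⟨m, cycIncl_injective e ?_⟩
  rw [← hq]
  simp

/-- An element of `ℤ[μ_e]` involves finitely many roots of unity. Keeping `n ∣ e` matters later: a
primitive `n`-th root then lies in `μ_e`, and `n` can be cancelled in `R`. -/
lemma exists_cycIncl_mem (b : Cyc e) :
    ∃ n : ℕ+, (Steinitz.ofPNat n).Divides e ∧ cycIncl e b ∈ cycField n := by
  obtain ⟨x, hx⟩ := b
  have two : ∀ x y : AlgNum,
      (∃ n : ℕ+, (Steinitz.ofPNat n).Divides e ∧ x ∈ cycField n) →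
      (∃ n : ℕ+, (Steinitz.ofPNat n).Divides e ∧ y ∈ cycField n) →
      ∃ n : ℕ+, (Steinitz.ofPNat n).Divides e ∧ x ∈ cycField n ∧ y ∈ cycField n := by
    rintro x y ⟨m, hm, hx⟩ ⟨n, hn, hy⟩
    refine ⟨PNat.lcm m n, Steinitz.divides_lcm hm hn, ?_, ?_⟩
    · exact cycField_mono (by rw [PNat.lcm_coe]; exact Nat.dvd_lcm_left _ _) hx
    · exact cycField_mono (by rw [PNat.lcm_coe]; exact Nat.dvd_lcm_right _ _) hy
  refine Subring.closure_induction
    (p := fun z hz => ∃ n : ℕ+, (Steinitz.ofPNat n).Divides e ∧ cycIncl e ⟨z, hz⟩ ∈ cycField n)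
    ?_ ?_ ?_ ?_ ?_ ?_ hx
  · rintro _ ⟨ζ, rfl⟩
    obtain ⟨d, hd, hpow⟩ := ζ.2
    exact ⟨d, hd, IntermediateField.subset_adjoin _ _ (cycIncl_root_pow (Subtype.ext hpow))⟩
  · exact ⟨1, e.divides_one, zero_mem (cycField _)⟩
  · exact ⟨1, e.divides_one, one_mem (cycField _)⟩
  · intro x y hx hy h1 h2
    obtain ⟨n, hn, h1, h2⟩ := two _ _ h1 h2
    exact ⟨n, hn, add_mem h1 h2⟩
  · rintro x hx ⟨n, hn, h1⟩
    exact ⟨n, hn, neg_mem h1⟩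
  · intro x y hx hy h1 h2
    obtain ⟨n, hn, h1, h2⟩ := two _ _ h1 h2
    exact ⟨n, hn, mul_mem h1 h2⟩

variable (e R) in
/-- The elements of `R'` with coefficients in the `n`-th cyclotomic field. -/
def extLevel (n : ℕ) : AddSubmonoid (ExtRing e R) :=
  AddSubmonoid.closure {y | ∃ (r : R) (b : Cyc e), cycIncl e b ∈ cycField n ∧ y = r ⊗ₜ[ℤ] b}

lemma extLevel_mono {m n : ℕ} (h : m ∣ n) : extLevel e R m ≤ extLevel e R n := by
  refine AddSubmonoid.closure_mono ?_
  rintro _ ⟨r, b, hb, rfl⟩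
  exact ⟨r, b, cycField_mono h hb, rfl⟩

lemma exists_mem_extLevel (x : ExtRing e R) :
    ∃ n : ℕ+, (Steinitz.ofPNat n).Divides e ∧ x ∈ extLevel e R n := by
  induction x using TensorProduct.induction_on with
  | zero => exact ⟨1, e.divides_one, zero_mem _⟩
  | tmul r b =>
    obtain ⟨n, hn, hb⟩ := exists_cycIncl_mem b
    exact ⟨n, hn, AddSubmonoid.subset_closure ⟨r, b, hb, rfl⟩⟩
  | add x y hx hy =>
    obtain ⟨m, hm, hx⟩ := hx
    obtain ⟨n, hn, hy⟩ := hy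
    refine ⟨PNat.lcm m n, Steinitz.divides_lcm hm hn, add_mem ?_ ?_⟩
    · exact extLevel_mono (by rw [PNat.lcm_coe]; exact Nat.dvd_lcm_left _ _) hx
    · exact extLevel_mono (by rw [PNat.lcm_coe]; exact Nat.dvd_lcm_right _ _) hy

/-- On `r ⊗ b` the sum is `r ⊗ Tr(c b)`, and the integer `Tr(c b)` moves to the left factor. -/
lemma exists_sum_extTwist_eq {n : ℕ} [NeZero n] {c : Cyc e} (hc : cycIncl e c ∈ cycField n)
    {x : ExtRing e R} (hx : x ∈ extLevel e R n) :
    ∃ r : R, ∑ σ : cycField n ≃ₐ[ℚ] cycField n,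
      extTwist e R (cycGal e (liftGal σ)) ((1 ⊗ₜ[ℤ] c) * x) = r ⊗ₜ[ℤ] 1 := by
  induction hx using AddSubmonoid.closure_induction with
  | mem x hx =>
    obtain ⟨r, b, hb, rfl⟩ := hx
    obtain ⟨m, hm⟩ := exists_cycTrace_eq (b := c * b) (n := n)
      (by rw [map_mul]; exact mul_mem hc hb)
    refine ⟨m • r, ?_⟩
    rw [TensorProduct.smul_tmul, zsmul_one, ← hm, cycTrace, TensorProduct.tmul_sum]
    refine Finset.sum_congr rfl fun σ _ => ?_
    rw [Algebra.TensorProduct.tmul_mul_tmul, one_mul, extTwist_tmul]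
  | zero => exact ⟨0, by simp⟩
  | add x y _ _ hx hy =>
    obtain ⟨r, hr⟩ := hx
    obtain ⟨s, hs⟩ := hy
    refine ⟨r + s, ?_⟩
    rw [TensorProduct.add_tmul, ← hr, ← hs, ← Finset.sum_add_distrib]
    exact Finset.sum_congr rfl fun σ _ => by rw [mul_add, map_add]

lemma exists_isPrimitiveRoot {n : ℕ+} (hn : (Steinitz.ofPNat n).Divides e) :
    ∃ ζ : mu e, IsPrimitiveRoot (cycIncl e (root e ζ)) n ∧ ζ ^ (n : ℕ) = 1 := by
  obtain ⟨z, hz⟩ := HasEnoughRootsOfUnity.exists_primitiveRoot Circle n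
  let ζ : mu e := ⟨z, n, hn, hz.pow_eq_one⟩
  have hζ : IsPrimitiveRoot ζ n :=
    IsPrimitiveRoot.of_map_of_injective (f := (mu e).subtype) hz Subtype.val_injective
  exact ⟨ζ, hζ.map_of_injective (f := (cycIncl e : Cyc e →* AlgNum).comp (root e))
    ((cycIncl_injective e).comp (root_injective e)), hζ.pow_eq_one⟩

/-- After exchanging the sums, `σ` contributes the geometric sum of `ζ⁻¹ σ(ζ)`. This is `n` for `σ =
1` and vanishes otherwise, the ratio then being a nontrivial `n`-th root of unity. Hence the traces
of the powers of `ζ` generate an ideal of `ℤ[μ_e]` containing `n`. -/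
lemma sum_root_mul_cycTrace {n : ℕ} [NeZero n] {ζ : mu e}
    (hζ : IsPrimitiveRoot (cycIncl e (root e ζ)) n) (hζn : ζ ^ n = 1) :
    ∑ i ∈ Finset.range n, root e ζ⁻¹ ^ i * cycTrace e n (root e ζ ^ i) = n := by
  have h1 : root e ζ⁻¹ * root e ζ = 1 := by rw [← map_mul, inv_mul_cancel, map_one]
  simp only [cycTrace, Finset.mul_sum, map_pow]
  rw [Finset.sum_comm, Finset.sum_eq_single 1]
  · have h : cycGal e (liftGal (1 : cycField n ≃ₐ[ℚ] cycField n)) (root e ζ) = root e ζ := by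
      refine cycIncl_injective e ?_
      rw [cycIncl_cycGal]
      exact liftGal_apply 1 ⟨_, IntermediateField.subset_adjoin _ _ hζ.pow_eq_one⟩
    simp [h, ← mul_pow, h1]
  · intro σ _ hσ
    simp only [← mul_pow]
    have hne : root e ζ⁻¹ * cycGal e (liftGal σ) (root e ζ) ≠ 1 := by
      intro h
      refine hσ (eq_one_of_liftGal_apply hζ ?_)
      rw [← cycIncl_cycGal]
      congr 1
      linear_combination root e ζ * h - cycGal e (liftGal σ) (root e ζ) * h1
    have hpow : (root e ζ⁻¹ * cycGal e (liftGal σ) (root e ζ)) ^ n = 1 := by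
      rw [mul_pow, ← map_pow, ← map_pow, ← map_pow, inv_pow, hζn]
      simp
    have := mul_geom_sum (root e ζ⁻¹ * cycGal e (liftGal σ) (root e ζ)) n
    rw [hpow, sub_self] at this
    exact (mul_eq_zero.1 this).resolve_left (sub_ne_zero.2 hne)
  · intro h
    exact absurd (Finset.mem_univ _) h

/-- If `r ⊗ 1` is divisible by `n` in `R'`, then so is `r` in `R`. -/
lemma exists_nsmul_eq_of_tmul_one {n : ℕ} {r : R} {x : ExtRing e R} (h : n • x = r ⊗ₜ[ℤ] 1) :
    ∃ s : R, r = n • s := by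
  let N : Submodule ℤ R := LinearMap.range ((n : ℤ) • (LinearMap.id : R →ₗ[ℤ] R))
  -- Over `R / nR` the tensor product is killed by `n`, so the class of `r` becomes zero after `⊗
  -- 1`; faithful flatness makes the class itself zero.
  have hN : ∀ y : (R ⧸ N) ⊗[ℤ] Cyc e, n • y = 0 := by
    intro y
    induction y using TensorProduct.induction_on with
    | zero => exact smul_zero _
    | add x y hx hy => rw [smul_add, hx, hy, add_zero]
    | tmul q b =>
      obtain ⟨q, rfl⟩ := N.mkQ_surjective q
      rw [TensorProduct.smul_tmul', ← map_nsmul]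
      have : N.mkQ (n • q) = 0 := by
        rw [Submodule.mkQ_apply, Submodule.Quotient.mk_eq_zero]
        exact ⟨q, by simp⟩
      rw [this, TensorProduct.zero_tmul]
  have h0 : N.mkQ r ⊗ₜ[ℤ] (1 : Cyc e) = 0 := by
    rw [← LinearMap.rTensor_tmul (Cyc e) N.mkQ 1 r, ← h, map_nsmul, hN]
  have h1 : N.mkQ r = 0 := tmul_one_injective e (R ⧸ N) (by
    simp only [h0, TensorProduct.zero_tmul])
  rw [Submodule.mkQ_apply, Submodule.Quotient.mk_eq_zero] at h1
  obtain ⟨s, hs⟩ := h1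
  exact ⟨s, by rw [← hs]; simp⟩

/-- The integers `m` for which `m • x` comes from `R`. -/
def descentIdeal (x : ExtRing e R) : Ideal ℤ where
  carrier := {m | ∃ r : R, m • x = r ⊗ₜ[ℤ] 1}
  zero_mem' := ⟨0, by rw [zero_smul, TensorProduct.zero_tmul]⟩
  add_mem' := by
    rintro a b ⟨r, hr⟩ ⟨s, hs⟩
    exact ⟨r + s, by rw [add_smul, hr, hs, TensorProduct.add_tmul]⟩
  smul_mem' := by
    rintro a b ⟨r, hr⟩
    exact ⟨a • r, by rw [smul_assoc, hr, TensorProduct.smul_tmul']⟩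

/-- The elements of `R'` that are invariant under the Galois group come from `R`. -/
lemma exists_eq_tmul_one
    (hR : ∀ d : ℕ+, (Steinitz.ofPNat d).Divides e → Function.Injective fun x : R => (d : ℕ) • x)
    {x : ExtRing e R} (hx : ∀ g : AbsGal, extTwist e R (cycGal e g) x = x) :
    ∃ r : R, x = r ⊗ₜ[ℤ] 1 := by
  obtain ⟨n, hn, hxn⟩ := exists_mem_extLevel x
  obtain ⟨ζ, hζ, hζn⟩ := exists_isPrimitiveRoot hn
  have hζmem : ∀ i : ℕ, cycIncl e (root e ζ ^ i) ∈ cycField n := fun i => by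
    have h : cycIncl e (root e ζ) ∈ cycField n :=
      IntermediateField.subset_adjoin ℚ _ hζ.pow_eq_one
    rw [map_pow]
    exact (cycField n).pow_mem h i
  -- For invariant `x`, summing the conjugates of `ζ ^ i x` gives `Tr(ζ ^ i) x`, which comes from
  -- `R`. So the integer `Tr(ζ ^ i)` lies in the descent ideal.
  have hI : ∀ i : ℕ, cycTrace e n (root e ζ ^ i) ∈ (descentIdeal x).map (algebraMap ℤ (Cyc e)) := by
    intro i
    obtain ⟨m, hm⟩ := exists_cycTrace_eq (hζmem i)
    obtain ⟨r, hr⟩ := exists_sum_extTwist_eq (hζmem i) hxn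
    rw [hm]
    refine Ideal.mem_map_of_mem (algebraMap ℤ (Cyc e)) (x := m) ⟨r, ?_⟩
    rw [← hr]
    simp only [map_mul, hx, extTwist_tmul]
    rw [← Finset.sum_mul, ← TensorProduct.tmul_sum]
    change _ = (1 ⊗ₜ[ℤ] cycTrace e n (root e ζ ^ i)) * x
    rw [hm, ← zsmul_one m, TensorProduct.tmul_smul, ← Algebra.TensorProduct.one_def, smul_mul_assoc,
      one_mul]
  -- The coefficients `ζ⁻ⁱ` are not integers, so `n` is first found in the extended ideal only;
  -- faithful flatness contracts that ideal back to the original one.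
  have hnI : (n : ℤ) ∈ descentIdeal x := by
    rw [← Ideal.comap_map_eq_self_of_faithfullyFlat (B := Cyc e) (descentIdeal x), Ideal.mem_comap]
    have := sum_root_mul_cycTrace hζ hζn
    rw [map_natCast, ← this]
    exact Ideal.sum_mem _ fun i _ => Ideal.mul_mem_left _ _ (hI i)
  obtain ⟨r, hr⟩ := hnI
  rw [natCast_zsmul] at hr
  obtain ⟨s, rfl⟩ := exists_nsmul_eq_of_tmul_one hr
  refine ⟨s, nsmul_ext_injective e (hR n hn) ?_⟩
  simp only [hr, TensorProduct.smul_tmul']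

end Descent

/-! ### Characters of torsion groups -/

section Characters

variable {Γ : Type*} [CommGroup Γ]

/-- The character of the discrete group `Γ` with the given underlying homomorphism. -/
def DDual.ofHom (f : Γ →* Circle) : DDual Γ :=
  letI : TopologicalSpace Γ := ⊥
  haveI : DiscreteTopology Γ := ⟨rfl⟩
  ContinuousMonoidHom.mk f continuous_of_discreteTopology

lemma DDual.mul_apply (χ ψ : DDual Γ) (γ : Γ) : (χ * ψ) γ = χ γ * ψ γ := rfl

lemma DDual.inv_apply (χ : DDual Γ) (γ : Γ) : χ⁻¹ γ = (χ γ)⁻¹ := rfl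

lemma DDual.isInducing_coe : Topology.IsInducing fun (χ : DDual Γ) (γ : Γ) => χ γ := by
  let : TopologicalSpace Γ := ⊥
  have : DiscreteTopology Γ := ⟨rfl⟩
  exact (ContinuousMonoidHom.isClosedEmbedding_coe (A := Γ) (B := Circle)).isInducing

lemma DDual.continuous_apply (γ : Γ) : Continuous fun χ : DDual Γ => χ γ :=
  (_root_.continuous_apply γ).comp DDual.isInducing_coe.continuous

instance DDual.compactSpace : CompactSpace (DDual Γ) :=
  letI : TopologicalSpace Γ := ⊥
  haveI : DiscreteTopology Γ := ⟨rfl⟩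
  inferInstanceAs (CompactSpace (PontryaginDual Γ))

/-- The circle is divisible, hence an injective abelian group by Baer's criterion; the additive
circle `ℝ / 2πℤ` serves as its additive model. -/
lemma exists_circle_extension (F : Subgroup Γ) (f : F →* Circle) :
    ∃ g : Γ →* Circle, ∀ x : F, g x = f x := by
  have : Fact ((0 : ℝ) < 2 * Real.pi) := ⟨by positivity⟩
  let E : AddCircle (2 * Real.pi) ≃+ Additive Circle :=
    { toEquiv := AddCircle.homeomorphCircle'.toEquiv.trans Additive.ofMul
      map_add' := fun x y => congrArg Additive.ofMul (Real.Angle.toCircle_add x y) }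
  obtain ⟨h, hh⟩ :=
    (Module.Baer.of_divisible (AddCircle (2 * Real.pi))).extension_property_addMonoidHom
      (MonoidHom.toAdditive F.subtype) (fun x y h => Subtype.val_injective h)
      ((E.symm : Additive Circle →+ AddCircle (2 * Real.pi)).comp (MonoidHom.toAdditive f))
  refine ⟨MonoidHom.toAdditive.symm ((E : _ →+ Additive Circle).comp h), fun x => ?_⟩
  have hx := DFunLike.congr_fun hh (Additive.ofMul x)
  change E (h (Additive.ofMul (x : Γ))) = Additive.ofMul (f x)
  rw [← E.eq_symm_apply]
  exact hx

/-- The finite cyclic group generated by `γ` has a character nontrivial at `γ`, which extends to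
`Γ`. -/
lemma exists_circle_ne_one {γ : Γ} (hγ : IsOfFinOrder γ) (h1 : γ ≠ 1) :
    ∃ g : Γ →* Circle, g γ ≠ 1 := by
  have : Finite (Subgroup.zpowers γ) := hγ.finite_zpowers
  obtain ⟨φ, hφ⟩ := CommGroup.exists_apply_ne_one_of_hasEnoughRootsOfUnity (Subgroup.zpowers γ)
    Circle (a := ⟨γ, Subgroup.mem_zpowers γ⟩) (by simpa [Subtype.ext_iff] using h1)
  obtain ⟨g, hg⟩ := exists_circle_extension _ (toUnits.symm.toMonoidHom.comp φ)
  refine ⟨g, ?_⟩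
  rw [hg ⟨γ, Subgroup.mem_zpowers γ⟩]
  simpa using hφ

lemma DDual.exists_apply_ne (hΓ : ∀ γ : Γ, IsOfFinOrder γ) {γ δ : Γ} (h : γ ≠ δ) :
    ∃ χ : DDual Γ, χ γ ≠ χ δ := by
  obtain ⟨g, hg⟩ := exists_circle_ne_one (hΓ (γ * δ⁻¹)) (fun h' => h (mul_inv_eq_one.1 h'))
  refine ⟨DDual.ofHom g, fun h' => hg ?_⟩
  rw [map_mul, map_inv, mul_inv_eq_one]
  exact h'

/-- A homomorphism to the circle on the dual of a torsion group with open kernel is the evaluation at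
an element. -/
lemma DDual.exists_eq_eval (hΓ : ∀ γ : Γ, IsOfFinOrder γ) (c : DDual Γ →* Circle)
    (hc : IsOpen {χ : DDual Γ | c χ = 1}) : ∃ γ : Γ, ∀ χ : DDual Γ, c χ = χ γ := by
  -- The dual carries the topology of pointwise convergence, so the open kernel contains every
  -- character that is trivial on a suitable finite set.
  obtain ⟨S, hSfin, hS⟩ : ∃ S : Set Γ, S.Finite ∧
      ∀ χ : DDual Γ, (∀ γ ∈ S, χ γ = 1) → c χ = 1 := by
    have h1 : {χ : DDual Γ | c χ = 1} ∈ nhds 1 := hc.mem_nhds (map_one c)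
    rw [DDual.isInducing_coe.nhds_eq_comap, Filter.mem_comap] at h1
    obtain ⟨t, ht, hts⟩ := h1
    rw [nhds_pi, Filter.mem_pi] at ht
    obtain ⟨S, hS, U, hU, hUt⟩ := ht
    refine ⟨S, hS, fun χ hχ => hts (hUt fun γ hγ => ?_)⟩
    change χ γ ∈ U γ
    rw [hχ γ hγ]
    exact mem_of_mem_nhds (hU γ)
  let F := Subgroup.closure S
  have hFfg : Group.FG F := (Group.fg_iff_subgroup_fg F).2 ⟨hSfin.toFinset, by simp [F]⟩
  have hFin : Finite F := CommGroup.finite_of_fg_isMulTorsion F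
    (fun x => F.subtype_injective.isOfFinOrder_iff.1 (hΓ x))
  -- `c` only sees restrictions to `F`, which is finite as a finitely generated abelian torsion
  -- group. So `c` induces a character of the dual of `F`, whatever extensions are chosen, and
  -- finite biduality yields `γ`.
  have hdep : ∀ χ ψ : DDual Γ, (∀ x : F, χ x = ψ x) → c χ = c ψ := by
    intro χ ψ h
    rw [← mul_inv_eq_one, ← map_inv, ← map_mul]
    refine hS _ fun γ hγ => ?_
    rw [DDual.mul_apply, DDual.inv_apply, mul_inv_eq_one]
    exact h ⟨γ, Subgroup.subset_closure hγ⟩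
  choose g hg using exists_circle_extension F
  let φ' : (F →* Circleˣ) → DDual Γ := fun φ => DDual.ofHom (g (toUnits.symm.toMonoidHom.comp φ))
  have hφ' : ∀ φ (x : F), φ' φ x = (φ x : Circle) := fun φ x => hg _ x
  let η : (F →* Circleˣ) →* Circleˣ := toUnits.toMonoidHom.comp
    { toFun := fun φ => c (φ' φ)
      map_one' := by
        rw [← map_one c]
        exact hdep _ _ fun x => hφ' 1 x
      map_mul' := fun φ ψ => by
        rw [← map_mul]
        refine hdep _ _ fun x => ?_
        rw [DDual.mul_apply, hφ', hφ', hφ']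
        rfl }
  let γ := CommGroup.monoidHomMonoidHomEquiv F Circle η
  refine ⟨γ, fun χ => ?_⟩
  let φ : F →* Circleˣ := toUnits.toMonoidHom.comp ((χ : Γ →* Circle).comp F.subtype)
  have h := CommGroup.apply_monoidHomMonoidHomEquiv Circle φ η
  calc c χ = c (φ' φ) := hdep _ _ fun x => (hφ' φ x).symm
    _ = χ γ := (congrArg Units.val h).symm

end Characters

/-! ### From gradings to homomorphisms -/

section Scale

variable {e : Steinitz} {k : Type*} {R : Type*} [CommRing k] [Ring R] [Algebra k R] {Γ : Type*}

lemma Grading.iSup_eq_top [Group Γ] (𝓡 : Grading k R Γ) : iSup 𝓡.comp = ⊤ := by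
  classical
  exact ((DirectSum.isInternal_submodule_iff_iSupIndep_and_iSup_eq_top _).1 𝓡.isInternal).2

lemma Grading.iSupIndep [Group Γ] (𝓡 : Grading k R Γ) : iSupIndep 𝓡.comp := by
  classical
  exact ((DirectSum.isInternal_submodule_iff_iSupIndep_and_iSup_eq_top _).1 𝓡.isInternal).1

open Classical in
lemma Grading.bijective [Group Γ] (𝓡 : Grading k R Γ) :
    Function.Bijective (DirectSum.coeAddMonoidHom 𝓡.comp) := 𝓡.isInternal

lemma Grading.induction [Group Γ] (𝓡 : Grading k R Γ) {p : R → Prop} (x : R)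
    (mem : ∀ γ, ∀ x ∈ 𝓡.comp γ, p x) (zero : p 0) (add : ∀ x y, p x → p y → p (x + y)) : p x :=
  Submodule.iSup_induction 𝓡.comp (motive := p) (𝓡.iSup_eq_top ▸ Submodule.mem_top) mem zero add

lemma Grading.ext_induction [Group Γ] (𝓡 : Grading k R Γ) {p : ExtRing e R → Prop}
    (y : ExtRing e R) (tmul : ∀ γ, ∀ x ∈ 𝓡.comp γ, ∀ s : Cyc e, p (x ⊗ₜ[ℤ] s)) (zero : p 0)
    (add : ∀ x y, p x → p y → p (x + y)) : p y := by
  induction y using TensorProduct.induction_on with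
  | zero => exact zero
  | add x y hx hy => exact add x y hx hy
  | tmul x s =>
    induction x using 𝓡.induction with
    | mem γ x hx => exact tmul γ x hx s
    | zero => rwa [TensorProduct.zero_tmul]
    | add x y hx hy => rw [TensorProduct.add_tmul]; exact add _ _ hx hy

variable [CommGroup Γ] (𝓡 : Grading k R Γ) (c : Γ →* mu e)

open Classical in
/-- The additive map `R → R'` that sends `x` of degree `γ` to `x ⊗ c γ`. -/
noncomputable def scaleAddHom : R →+ ExtRing e R :=
  (DirectSum.toAddMonoid fun γ =>
      ((TensorProduct.mk ℤ R (Cyc e)).flip (root e (c γ))).toAddMonoidHom.comp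
        (𝓡.comp γ).subtype.toAddMonoidHom).comp
    (AddEquiv.ofBijective (DirectSum.coeAddMonoidHom 𝓡.comp) 𝓡.bijective).symm.toAddMonoidHom

variable {𝓡} in
lemma scaleAddHom_of_mem {γ : Γ} {x : R} (hx : x ∈ 𝓡.comp γ) :
    scaleAddHom 𝓡 c x = x ⊗ₜ[ℤ] root e (c γ) := by
  classical
  have : (AddEquiv.ofBijective (DirectSum.coeAddMonoidHom 𝓡.comp) 𝓡.bijective).symm x =
      DirectSum.of (fun γ => 𝓡.comp γ) γ ⟨x, hx⟩ := by
    rw [AddEquiv.symm_apply_eq, AddEquiv.ofBijective_apply]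
    simp
  rw [scaleAddHom, AddMonoidHom.comp_apply]
  change DirectSum.toAddMonoid _
    ((AddEquiv.ofBijective (DirectSum.coeAddMonoidHom 𝓡.comp) 𝓡.bijective).symm x) = _
  rw [this, DirectSum.toAddMonoid_of]
  rfl

/-- The ring homomorphism `R → R'` that sends `x` of degree `γ` to `x ⊗ c γ`. -/
noncomputable def scaleRingHom : R →+* ExtRing e R :=
  { scaleAddHom 𝓡 c with
    map_one' := by
      change scaleAddHom 𝓡 c 1 = 1
      rw [scaleAddHom_of_mem c 𝓡.one_mem, map_one, map_one, Algebra.TensorProduct.one_def]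
    map_mul' := fun x y => by
      change scaleAddHom 𝓡 c (x * y) = scaleAddHom 𝓡 c x * scaleAddHom 𝓡 c y
      induction x using 𝓡.induction with
      | zero => rw [zero_mul, map_zero, zero_mul]
      | add x x' hx hx' => rw [add_mul, map_add, map_add, add_mul, hx, hx']
      | mem γ x hx =>
        induction y using 𝓡.induction with
        | zero => rw [mul_zero, map_zero, mul_zero]
        | add y y' hy hy' => rw [mul_add, map_add, map_add, mul_add, hy, hy']
        | mem δ y hy =>
          rw [scaleAddHom_of_mem c (𝓡.mul_mem hx hy), scaleAddHom_of_mem c hx,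
            scaleAddHom_of_mem c hy, Algebra.TensorProduct.tmul_mul_tmul, map_mul, map_mul] }

/-- The ring endomorphism of `R'` that is multiplication by `c γ` on elements of degree `γ`. -/
noncomputable def scaleAlgHom : ExtRing e R →ₐ[ℤ] ExtRing e R :=
  Algebra.TensorProduct.lift (scaleRingHom 𝓡 c).toIntAlgHom Algebra.TensorProduct.includeRight
    fun _ s => (one_tmul_comm e s _).symm

variable {𝓡} in
lemma scaleAlgHom_tmul {γ : Γ} {x : R} (hx : x ∈ 𝓡.comp γ) (s : Cyc e) :
    scaleAlgHom 𝓡 c (x ⊗ₜ[ℤ] s) = x ⊗ₜ[ℤ] (root e (c γ) * s) := by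
  refine (Algebra.TensorProduct.lift_tmul _ _ _ x s).trans ?_
  change scaleAddHom 𝓡 c x * (1 ⊗ₜ[ℤ] s) = _
  rw [scaleAddHom_of_mem c hx, Algebra.TensorProduct.tmul_mul_tmul, mul_one]

lemma scaleAlgHom_mul (c c' : Γ →* mu e) (y : ExtRing e R) :
    scaleAlgHom 𝓡 (c * c') y = scaleAlgHom 𝓡 c (scaleAlgHom 𝓡 c' y) := by
  induction y using 𝓡.ext_induction with
  | zero => simp only [map_zero]
  | add x y hx hy => simp only [map_add, hx, hy]
  | tmul γ x hx s =>
    rw [scaleAlgHom_tmul _ hx, scaleAlgHom_tmul _ hx, scaleAlgHom_tmul _ hx, MonoidHom.mul_apply,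
      map_mul, mul_assoc]

lemma scaleAlgHom_one (y : ExtRing e R) : scaleAlgHom 𝓡 (1 : Γ →* mu e) y = y := by
  induction y using 𝓡.ext_induction with
  | zero => simp only [map_zero]
  | add x y hx hy => simp only [map_add, hx, hy]
  | tmul γ x hx s => rw [scaleAlgHom_tmul _ hx, MonoidHom.one_apply, map_one, one_mul]

/-- Scalars from `k` are homogeneous of degree `1`, where the scaling factor is `1`. -/
lemma scaleAlgHom_algebraMap (z : ExtRing e k) :
    scaleAlgHom 𝓡 c (algebraMap (ExtRing e k) (ExtRing e R) z) =
      algebraMap (ExtRing e k) (ExtRing e R) z := by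
  induction z using TensorProduct.induction_on with
  | zero => simp only [map_zero]
  | add x y hx hy => simp only [map_add, hx, hy]
  | tmul a s =>
    change scaleAlgHom 𝓡 c (algebraMap k R a ⊗ₜ[ℤ] s) = algebraMap k R a ⊗ₜ[ℤ] s
    have ha : algebraMap k R a ∈ 𝓡.comp 1 := by
      rw [Algebra.algebraMap_eq_smul_one]
      exact Submodule.smul_mem _ _ 𝓡.one_mem
    rw [scaleAlgHom_tmul c ha, map_one, map_one, one_mul]

/-- The automorphism of `R'` that is multiplication by `c γ` on elements of degree `γ`. -/
noncomputable def scaleAut : ExtAut e k R where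
  toFun := scaleAlgHom 𝓡 c
  invFun := scaleAlgHom 𝓡 c⁻¹
  left_inv y := by rw [← scaleAlgHom_mul, inv_mul_cancel, scaleAlgHom_one]
  right_inv y := by rw [← scaleAlgHom_mul, mul_inv_cancel, scaleAlgHom_one]
  map_mul' := map_mul _
  map_add' := map_add _
  commutes' := scaleAlgHom_algebraMap 𝓡 c

variable {𝓡} in
lemma scaleAut_tmul {γ : Γ} {x : R} (hx : x ∈ 𝓡.comp γ) (s : Cyc e) :
    scaleAut 𝓡 c (x ⊗ₜ[ℤ] s) = x ⊗ₜ[ℤ] (root e (c γ) * s) :=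
  scaleAlgHom_tmul c hx s

variable {𝓡} in
lemma tmul_mem_eigenspace_scaleAut {γ : Γ} {x : R} (hx : x ∈ 𝓡.comp γ) (s : Cyc e) :
    x ⊗ₜ[ℤ] s ∈ Module.End.eigenspace (scaleAut 𝓡 c).toLinearMap (rootExt e k (c γ)) := by
  rw [Module.End.mem_eigenspace_iff, AlgEquiv.toLinearMap_apply, scaleAut_tmul c hx,
    rootExt_smul, rootR_mul_tmul]

lemma eq_zero_of_rootExt_smul_eq
    (hR : ∀ d : ℕ+, (Steinitz.ofPNat d).Divides e → Function.Injective fun x : R => (d : ℕ) • x)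
    (ζ η : mu e) (h : ζ ≠ η) (y : ExtRing e R) (hy : rootExt e k ζ • y = rootExt e k η • y) :
    y = 0 := by
  rw [rootExt_smul, rootExt_smul] at hy
  exact eq_zero_of_rootR_mul_eq hR h hy

lemma scaleAut_mem_XSet
    (hR : ∀ d : ℕ+, (Steinitz.ofPNat d).Divides e → Function.Injective fun x : R => (d : ℕ) • x) :
    scaleAut 𝓡 c ∈ XSet e k R := by
  have hdiag : IsDiag (rootExt e k) (scaleAut 𝓡 c).toLinearMap := by
    refine isDiag_iff.2 ⟨iSupIndep_eigenspace (eq_zero_of_rootExt_smul_eq hR), eq_top_iff.2 ?_⟩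
    intro y _
    induction y using 𝓡.ext_induction with
    | zero => exact zero_mem _
    | add x y hx hy => exact add_mem (hx trivial) (hy trivial)
    | tmul γ x hx s =>
      exact Submodule.mem_iSup_of_mem (c γ) (tmul_mem_eigenspace_scaleAut c hx s)
  -- On `x ⊗ s` with `x` of degree `γ`, both sides equal `x ⊗ (c γ) ^ a s`.
  refine ⟨hdiag, fun a _ τ hτ y => ?_⟩
  induction y using 𝓡.ext_induction with
  | zero => simp only [map_zero]
  | add x y hx hy => simp only [map_add, hx, hy]
  | tmul γ x hx s =>
    rw [diagMap_apply_of_mem hdiag (mu.zpow a) (tmul_mem_eigenspace_scaleAut c hx s),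
      extTwist_symm_tmul, scaleAut_tmul c hx, extTwist_tmul, rootExt_smul, rootR_mul_tmul, map_mul, hτ,
      RingEquiv.apply_symm_apply]

end Scale

section DualHom

variable {e : Steinitz} {k : Type*} {R : Type*} [CommRing k] [Ring R] [Algebra k R] {Γ : Type*}
  [CommGroup Γ]

/-- A character of an `e`-torsion group, as a homomorphism to `μ_e`. -/
noncomputable def DDual.toMu (hΓ : ∀ γ : Γ, IsETorsion e γ) (χ : DDual Γ) : Γ →* mu e where
  toFun γ := ⟨χ γ, by
    obtain ⟨d, hd, h⟩ := hΓ γ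
    exact ⟨d, hd, by rw [← map_pow, h, map_one]⟩⟩
  map_one' := Subtype.ext (map_one χ)
  map_mul' γ δ := Subtype.ext (map_mul χ γ δ)

/-- Since `R'` is discrete, the compact-open topology is that of pointwise convergence. -/
lemma ExtAut.continuous_iff {X : Type*} [TopologicalSpace X] (F : X → ExtAut e k R) :
    @Continuous _ _ _ (ExtAut.topology e k R) F ↔
      ∀ y : ExtRing e R, @Continuous _ _ _ ⊥ fun x => F x y := by
  let : TopologicalSpace (ExtRing e R) := ⊥
  have : DiscreteTopology (ExtRing e R) := ⟨rfl⟩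
  rw [continuous_induced_rng]
  constructor
  · intro h y
    exact (continuous_eval_const (F := C(ExtRing e R, ExtRing e R)) y).comp h
  · intro h
    refine ContinuousMap.continuous_of_continuous_uncurry _ ?_
    rw [continuous_prod_of_discrete_right]
    exact h

lemma finite_circle_pow_eq_one (d : ℕ+) : {z : Circle | z ^ (d : ℕ) = 1}.Finite := by
  have h : {z : ℂ | z ^ (d : ℕ) = 1}.Finite :=
    (Polynomial.nthRootsFinset d (1 : ℂ)).finite_toSet.subset fun z hz =>
      (Polynomial.mem_nthRootsFinset d.pos 1).2 hz
  refine (h.preimage Circle.coe_injective.injOn).subset fun z hz => ?_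
  exact (Circle.coe_pow z d).symm.trans (congrArg (fun w : Circle => (w : ℂ)) hz)

/-- The values `χ(γ)` lie in the finite, hence discrete, set of `d`-th roots of unity, so any
function of them is continuous. -/
lemma DDual.continuous_comp_toMu (hΓ : ∀ γ : Γ, IsETorsion e γ) (γ : Γ) {Y : Type*}
    [TopologicalSpace Y] (F : mu e → Y) : Continuous fun χ : DDual Γ => F (χ.toMu hΓ γ) := by
  obtain ⟨d, hd, h⟩ := hΓ γ
  have : Finite {z : Circle | z ^ (d : ℕ) = 1} := finite_circle_pow_eq_one d
  let G : {z : Circle | z ^ (d : ℕ) = 1} → Y := fun z => F ⟨z, d, hd, z.2⟩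
  have hG : Continuous G := continuous_of_discreteTopology
  have hpow : ∀ χ : DDual Γ, χ γ ∈ {z : Circle | z ^ (d : ℕ) = 1} := fun χ => by
    change χ γ ^ (d : ℕ) = 1
    rw [← map_pow, h, map_one]
  exact hG.comp ((DDual.continuous_apply γ).subtype_mk hpow)

/-- The homomorphism attached to a grading. -/
noncomputable def Grading.toDualHom
    (hR : ∀ d : ℕ+, (Steinitz.ofPNat d).Divides e → Function.Injective fun x : R => (d : ℕ) • x)
    (hΓ : ∀ γ : Γ, IsETorsion e γ) (𝓡 : Grading k R Γ) : DualHom e k R Γ where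
  toHom :=
    { toFun := fun χ => scaleAut 𝓡 (χ.toMu hΓ)
      map_one' := AlgEquiv.ext fun y => scaleAlgHom_one 𝓡 y
      map_mul' := fun χ ψ => AlgEquiv.ext fun y => scaleAlgHom_mul 𝓡 (χ.toMu hΓ) (ψ.toMu hΓ) y }
  continuous_toHom := by
    rw [ExtAut.continuous_iff]
    intro y
    let : TopologicalSpace (ExtRing e R) := ⊥
    have : DiscreteTopology (ExtRing e R) := ⟨rfl⟩
    change Continuous fun χ : DDual Γ => scaleAut 𝓡 (χ.toMu hΓ) y
    induction y using 𝓡.ext_induction with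
    | zero => simp only [map_zero]; exact continuous_const
    | add x y hx hy =>
      simp only [map_add]
      exact (continuous_of_discreteTopology (f := fun p : ExtRing e R × ExtRing e R => p.1 + p.2)).comp
        (hx.prodMk hy)
    | tmul γ x hx s =>
      simp only [scaleAut_tmul _ hx]
      exact DDual.continuous_comp_toMu hΓ γ fun ζ => x ⊗ₜ[ℤ] (root e ζ * s)
  range_subset := by
    rintro _ ⟨χ, rfl⟩
    exact scaleAut_mem_XSet 𝓡 _ hR

lemma Grading.toDualHom_tmul
    (hR : ∀ d : ℕ+, (Steinitz.ofPNat d).Divides e → Function.Injective fun x : R => (d : ℕ) • x)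
    (hΓ : ∀ γ : Γ, IsETorsion e γ) (𝓡 : Grading k R Γ) (χ : DDual Γ) {γ : Γ} {x : R}
    (hx : x ∈ 𝓡.comp γ) (s : Cyc e) :
    (𝓡.toDualHom hR hΓ).toHom χ (x ⊗ₜ[ℤ] s) = x ⊗ₜ[ℤ] (root e (χ.toMu hΓ γ) * s) :=
  scaleAut_tmul _ hx s

end DualHom

/-! ### From homomorphisms to gradings -/

section Joint

variable {e : Steinitz} {k : Type*} {R : Type*} [CommRing k] [Ring R] [Algebra k R] {G : Type*}
  [CommGroup G]

lemma ExtAut.map_rootR_mul (σ : ExtAut e k R) (ζ : mu e) (y : ExtRing e R) :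
    σ (rootR e R ζ * y) = rootR e R ζ * σ y := by
  rw [← rootExt_smul (k := k), ← rootExt_smul (k := k)]
  exact map_smul σ _ _

/-- For commuting diagonalizable automorphisms, a sum of joint eigenvectors for a set `T` is a sum of
joint eigenvectors for a set that is larger by finitely many elements. -/
lemma mem_closure_joint_eigenvectors {φ : G →* ExtAut e k R}
    (hφ : ∀ χ, IsDiag (rootExt e k) (φ χ).toLinearMap) (T : Set G) (S : Finset G) {y : ExtRing e R}
    (hy : ∀ χ ∈ T, ∃ ζ : mu e, φ χ y = rootR e R ζ * y) :
    y ∈ AddSubmonoid.closure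
      {z | ∀ χ, χ ∈ T ∨ χ ∈ S → ∃ ζ : mu e, φ χ z = rootR e R ζ * z} := by
  classical
  induction S using Finset.induction_on with
  | empty =>
    refine AddSubmonoid.subset_closure fun χ hχ => hy χ ?_
    simpa using hχ
  | insert ψ S _ ih =>
    refine (AddSubmonoid.closure_le.2 ?_) ih
    intro z hz
    -- Splitting `z` along `φ ψ` preserves the eigenvalues already obtained, because the
    -- automorphisms commute.
    obtain ⟨s, v, hv, rfl, hcomm⟩ := (hφ ψ).exists_sum_eigenvectors z
    refine AddSubmonoid.sum_mem _ fun i hi => AddSubmonoid.subset_closure fun χ hχ => ?_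
    by_cases hχψ : χ = ψ
    · refine ⟨i, ?_⟩
      rw [hχψ, ← rootExt_smul (k := k)]
      exact hv i hi
    · obtain ⟨ζ, hζ⟩ := hz χ (by
        rcases hχ with h | h
        · exact Or.inl h
        · exact Or.inr ((Finset.mem_insert.1 h).resolve_left hχψ))
      refine ⟨ζ, ?_⟩
      rw [← rootExt_smul (k := k)] at hζ ⊢
      refine hcomm (φ χ).toLinearMap _ ?_ hζ i hi
      refine LinearMap.ext fun w => ?_
      change (φ χ * φ ψ) w = (φ ψ * φ χ) w
      rw [← map_mul, ← map_mul, mul_comm]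

end Joint

section ToGrading

variable {e : Steinitz} {k : Type*} {R : Type*} [CommRing k] [Ring R] [Algebra k R] {Γ : Type*}
  [CommGroup Γ]

lemma DualHom.isDiag (φ : DualHom e k R Γ) (χ : DDual Γ) :
    IsDiag (rootExt e k) (φ.toHom χ).toLinearMap := (φ.range_subset ⟨χ, rfl⟩).1

lemma DualHom.isOpen_setOf_apply_eq (φ : DualHom e k R Γ) (y : ExtRing e R) :
    IsOpen {χ : DDual Γ | φ.toHom χ y = y} := by
  let : TopologicalSpace (ExtRing e R) := ⊥
  have : DiscreteTopology (ExtRing e R) := ⟨rfl⟩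
  exact (isOpen_discrete {y}).preimage ((ExtAut.continuous_iff _).1 φ.continuous_toHom y)

/-- The part of `R'` of degree `γ`. -/
noncomputable def DualHom.extComp (hΓ : ∀ γ : Γ, IsETorsion e γ) (φ : DualHom e k R Γ) (γ : Γ) :
    Submodule (ExtRing e k) (ExtRing e R) :=
  ⨅ χ : DDual Γ, Module.End.eigenspace (φ.toHom χ).toLinearMap (rootExt e k (χ.toMu hΓ γ))

lemma DualHom.mem_extComp {hΓ : ∀ γ : Γ, IsETorsion e γ} {φ : DualHom e k R Γ} {γ : Γ}
    {y : ExtRing e R} :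
    y ∈ φ.extComp hΓ γ ↔ ∀ χ : DDual Γ, φ.toHom χ y = rootR e R (χ.toMu hΓ γ) * y := by
  simp only [DualHom.extComp, Submodule.mem_iInf, Module.End.mem_eigenspace_iff, rootExt_smul]
  rfl

lemma isOfFinOrder_of_isETorsion (hΓ : ∀ γ : Γ, IsETorsion e γ) (γ : Γ) : IsOfFinOrder γ := by
  obtain ⟨d, -, h⟩ := hΓ γ
  exact isOfFinOrder_iff_pow_eq_one.2 ⟨d, d.pos, h⟩

variable
    (hR : ∀ d : ℕ+, (Steinitz.ofPNat d).Divides e → Function.Injective fun x : R => (d : ℕ) • x)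
    (hΓ : ∀ γ : Γ, IsETorsion e γ) (φ : DualHom e k R Γ)

include hR

/-- Characters separate the points of a torsion group, so distinct degrees have distinct eigenvalues
at some `χ`. -/
lemma DualHom.iSupIndep_extComp : iSupIndep (φ.extComp hΓ) := by
  refine iSupIndep_iInf_eigenspace fun γ δ h => ?_
  obtain ⟨χ, hχ⟩ := DDual.exists_apply_ne (isOfFinOrder_of_isETorsion hΓ) h
  refine ⟨χ, eq_zero_of_rootExt_smul_eq hR _ _ fun h' => hχ ?_⟩
  exact congrArg Subtype.val h'

/-- A joint eigenvector is homogeneous. -/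
lemma DualHom.exists_mem_extComp {z : ExtRing e R}
    (hz : ∀ χ, ∃ ζ : mu e, φ.toHom χ z = rootR e R ζ * z) : ∃ γ, z ∈ φ.extComp hΓ γ := by
  by_cases hz0 : z = 0
  · exact ⟨1, hz0 ▸ zero_mem _⟩
  choose c hc using hz
  -- The eigenvalue on a nonzero vector is unique, which makes `χ ↦ c χ` multiplicative. Its kernel
  -- is the stabilizer of `z`, which is open.
  have huniq : ∀ ζ η : mu e, rootR e R ζ * z = rootR e R η * z → ζ = η := by
    intro ζ η h
    by_contra hne
    exact hz0 (eq_zero_of_rootR_mul_eq hR hne h)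
  let C : DDual Γ →* mu e :=
    { toFun := c
      map_one' := huniq _ _ (by rw [← hc, map_one, rootR_one, one_mul]; rfl)
      map_mul' := fun χ ψ => huniq _ _ (by
        rw [← hc, map_mul, AlgEquiv.mul_apply, hc, ExtAut.map_rootR_mul, hc, rootR_mul,
          ← mul_assoc, one_tmul_comm e (root e (c ψ)) (rootR e R (c χ))]) }
  obtain ⟨γ, hγ⟩ := DDual.exists_eq_eval (isOfFinOrder_of_isETorsion hΓ) ((mu e).subtype.comp C) (by
    have : {χ : DDual Γ | (mu e).subtype.comp C χ = 1} = {χ : DDual Γ | φ.toHom χ z = z} := by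
      ext χ
      change (c χ : Circle) = 1 ↔ φ.toHom χ z = z
      rw [hc]
      constructor
      · intro h
        rw [show c χ = 1 from Subtype.ext h, rootR_one, one_mul]
      · intro h
        rw [huniq (c χ) 1 (by rw [h, rootR_one, one_mul])]
        rfl
    rw [this]
    exact φ.isOpen_setOf_apply_eq z)
  refine ⟨γ, DualHom.mem_extComp.2 fun χ => ?_⟩
  rw [hc, show c χ = χ.toMu hΓ γ from Subtype.ext (hγ χ)]

lemma DualHom.iSup_extComp : iSup (φ.extComp hΓ) = ⊤ := by
  refine eq_top_iff.2 fun y _ => ?_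
  let U : Subgroup (DDual Γ) :=
    { carrier := {χ | φ.toHom χ y = y}
      one_mem' := by
        change φ.toHom 1 y = y
        rw [map_one]
        rfl
      mul_mem' := by
        intro χ ψ hχ hψ
        change φ.toHom (χ * ψ) y = y
        rw [map_mul, AlgEquiv.mul_apply, show φ.toHom ψ y = y from hψ, show φ.toHom χ y = y from hχ]
      inv_mem' := by
        intro χ hχ
        change φ.toHom χ⁻¹ y = y
        rw [map_inv]
        exact (AlgEquiv.symm_apply_eq _).2 (show y = φ.toHom χ y from hχ.symm) }
  -- An open subgroup of a compact group has finite index. A joint eigenvector for `U` and for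
  -- representatives of its cosets is one for the whole dual.
  have hU : Finite (DDual Γ ⧸ U) := U.quotient_finite_of_isOpen (φ.isOpen_setOf_apply_eq y)
  obtain ⟨S, hS⟩ : ∃ S : Finset (DDual Γ), ∀ χ, ∃ ψ ∈ S, ψ⁻¹ * χ ∈ U := by
    classical
    have := Fintype.ofFinite (DDual Γ ⧸ U)
    refine ⟨Finset.univ.image (Quotient.out : DDual Γ ⧸ U → DDual Γ), fun χ =>
      ⟨(χ : DDual Γ ⧸ U).out, Finset.mem_image_of_mem _ (Finset.mem_univ _), ?_⟩⟩
    rw [← QuotientGroup.eq, QuotientGroup.out_eq']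
  have hy := mem_closure_joint_eigenvectors φ.isDiag (U : Set (DDual Γ)) S (y := y)
    fun χ hχ => ⟨1, by rw [rootR_one, one_mul]; exact hχ⟩
  refine (AddSubmonoid.closure_le (S := (iSup (φ.extComp hΓ)).toAddSubmonoid)).2 ?_ hy
  intro z hz
  obtain ⟨γ, hγ⟩ := φ.exists_mem_extComp hR hΓ (z := z) fun χ => by
    obtain ⟨ψ, hψ, hψχ⟩ := hS χ
    obtain ⟨ζ, hζ⟩ := hz ψ (Or.inr hψ)
    obtain ⟨η, hη⟩ := hz _ (Or.inl hψχ)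
    refine ⟨η * ζ, ?_⟩
    rw [← mul_inv_cancel_left ψ χ, map_mul, AlgEquiv.mul_apply, hη, ExtAut.map_rootR_mul, hζ,
      rootR_mul, mul_assoc]
  exact Submodule.mem_iSup_of_mem γ hγ

/-- If `σ y = ζ y`, then `σ ^ a (τ y) = τ (σ y) = ζ ^ a τ y`. As `a` acts injectively on `μ_e`, this
forces `σ (τ y) = ζ τ y`. -/
lemma DualHom.extTwist_mem_extComp (g : AbsGal) {γ : Γ} {y : ExtRing e R}
    (hy : y ∈ φ.extComp hΓ γ) : extTwist e R (cycGal e g) y ∈ φ.extComp hΓ γ := by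
  rw [DualHom.mem_extComp] at hy
  refine (Submodule.mem_iInf _).2 fun χ => ?_
  obtain ⟨hσ, h⟩ := φ.range_subset ⟨χ, rfl⟩
  have hinj : Function.Injective (mu.zpow (e := e) (cycCharHat g)) := by
    intro ζ η hζη
    refine root_injective e ((cycGal e g).injective ?_)
    rw [cycGal_root, cycGal_root, hζη]
  refine mem_eigenspace_of_diagMap_apply_eq hσ hinj (eq_zero_of_rootExt_smul_eq hR) ?_
  rw [← h (cycCharHat g) (isUnit_mk_cycCharHat g) (cycGal e g) (cycGal_root g),
    RingEquiv.symm_apply_apply, hy, map_mul, extTwist_rootR _ (cycGal_root g _), rootExt_smul]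

/-- The homogeneous components of an element of `R`. -/
lemma DualHom.exists_sum_eq (x : R) : ∃ (s : Finset Γ) (r : Γ → R),
    (∀ γ ∈ s, r γ ⊗ₜ[ℤ] 1 ∈ φ.extComp hΓ γ) ∧ x = ∑ γ ∈ s, r γ := by
  obtain ⟨s, v, hv, hx⟩ := exists_sum_of_iSup_eq_top (φ.iSup_extComp hR hΓ) (x ⊗ₜ[ℤ] 1)
  have hind := φ.iSupIndep_extComp hR hΓ
  rw [iSupIndep_iff_finsetSum_eq_zero_imp_eq_zero] at hind
  -- The element `x ⊗ 1` is Galois-invariant and the action preserves degrees, so uniqueness of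
  -- components makes each component invariant.
  have hinv : ∀ γ ∈ s, ∀ g : AbsGal, extTwist e R (cycGal e g) (v γ) = v γ := by
    intro γ hγ g
    refine sub_eq_zero.1 (hind s (fun γ => extTwist e R (cycGal e g) (v γ) - v γ) (fun δ _ => ?_) ?_
      γ hγ)
    · exact sub_mem (φ.extTwist_mem_extComp hR hΓ g (hv δ)) (hv δ)
    · rw [Finset.sum_sub_distrib, ← map_sum, ← hx, extTwist_tmul, map_one, sub_self]
  have hr : ∀ γ, ∃ r : R, γ ∈ s → v γ = r ⊗ₜ[ℤ] 1 := by
    intro γ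
    by_cases hγ : γ ∈ s
    · obtain ⟨r, hr⟩ := exists_eq_tmul_one hR (hinv γ hγ)
      exact ⟨r, fun _ => hr⟩
    · exact ⟨0, fun h => absurd h hγ⟩
  choose r hr using hr
  refine ⟨s, r, fun γ hγ => hr γ hγ ▸ hv γ, tmul_one_injective e R ?_⟩
  simp only [hx, TensorProduct.sum_tmul]
  exact Finset.sum_congr rfl hr

/-- The grading attached to a homomorphism. -/
noncomputable def DualHom.toGrading : Grading k R Γ where
  comp γ :=
    { carrier := {x | ∀ χ : DDual Γ, φ.toHom χ (x ⊗ₜ[ℤ] 1) = x ⊗ₜ[ℤ] root e (χ.toMu hΓ γ)}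
      zero_mem' := fun χ => by rw [TensorProduct.zero_tmul, TensorProduct.zero_tmul, map_zero]
      add_mem' := fun {x y} hx hy χ => by
        rw [TensorProduct.add_tmul, TensorProduct.add_tmul, map_add, hx χ, hy χ]
      smul_mem' := fun a x hx χ => by
        have h : ∀ s : Cyc e, (a • x) ⊗ₜ[ℤ] s =
            ((a ⊗ₜ[ℤ] 1 : ExtRing e k) • (x ⊗ₜ[ℤ] s : ExtRing e R)) := fun s => by
          rw [tmul_smul_tmul, one_mul]
        rw [h, h, ← hx χ]
        exact map_smul (φ.toHom χ) _ _ }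
  isInternal := by
    have hmem : ∀ (γ : Γ) (x : R), x ⊗ₜ[ℤ] 1 ∈ φ.extComp hΓ γ ↔
        ∀ χ : DDual Γ, φ.toHom χ (x ⊗ₜ[ℤ] 1) = x ⊗ₜ[ℤ] root e (χ.toMu hΓ γ) := by
      intro γ x
      rw [DualHom.mem_extComp]
      simp only [rootR_mul_tmul_one]
    classical
    refine (DirectSum.isInternal_submodule_iff_iSupIndep_and_iSup_eq_top _).2 ⟨?_, ?_⟩
    · rw [iSupIndep_iff_finsetSum_eq_zero_imp_eq_zero]
      intro s v hv hsum γ hγ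
      have hind := φ.iSupIndep_extComp hR hΓ
      rw [iSupIndep_iff_finsetSum_eq_zero_imp_eq_zero] at hind
      refine tmul_one_injective e R ?_
      simp only [TensorProduct.zero_tmul]
      refine hind s (fun γ => v γ ⊗ₜ[ℤ] 1) (fun δ hδ => (hmem δ _).2 (hv δ hδ)) ?_ γ hγ
      rw [← TensorProduct.sum_tmul, hsum, TensorProduct.zero_tmul]
    · refine eq_top_iff.2 fun x _ => ?_
      obtain ⟨s, r, hr, rfl⟩ := φ.exists_sum_eq hR hΓ x
      exact Submodule.sum_mem _ fun γ hγ =>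
        Submodule.mem_iSup_of_mem γ ((hmem γ (r γ)).1 (hr γ hγ))
  one_mem := fun χ => by
    rw [map_one, map_one, ← Algebra.TensorProduct.one_def, map_one]
  mul_mem := fun {γ δ x y} hx hy χ => by
    have h : (x * y) ⊗ₜ[ℤ] (1 : Cyc e) = (x ⊗ₜ[ℤ] 1) * (y ⊗ₜ[ℤ] 1) := by
      rw [Algebra.TensorProduct.tmul_mul_tmul, one_mul]
    rw [h, map_mul, hx χ, hy χ, Algebra.TensorProduct.tmul_mul_tmul, map_mul, map_mul]

end ToGrading

/-! ### The natural isomorphism -/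

section Iso

variable {e : Steinitz} {k : Type*} {R : Type*} [CommRing k] [Ring R] [Algebra k R] {Γ Δ : Type*}
  [CommGroup Γ] [CommGroup Δ]
  (hR : ∀ d : ℕ+, (Steinitz.ofPNat d).Divides e → Function.Injective fun x : R => (d : ℕ) • x)
  (hΓ : ∀ γ : Γ, IsETorsion e γ) (hΔ : ∀ γ : Δ, IsETorsion e γ)

/-- A grading is determined by lower bounds for its components. -/
lemma Grading.eq_of_le {𝓡 𝓢 : Grading k R Γ} (h : ∀ γ, 𝓡.comp γ ≤ 𝓢.comp γ) : 𝓡 = 𝓢 := by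
  refine Grading.ext (funext fun γ => le_antisymm (h γ) fun x hx => ?_)
  classical
  obtain ⟨s, v, hv, rfl⟩ := exists_sum_of_iSup_eq_top 𝓡.iSup_eq_top x
  have hind := 𝓢.iSupIndep
  rw [iSupIndep_iff_finsetSum_eq_zero_imp_eq_zero] at hind
  set x := ∑ i ∈ s, v i with hxdef
  -- Two decompositions of `x` in `𝓢` are compared: the family `v`, and `x` itself placed in degree
  -- `γ`. Inserting `γ` covers the case `γ ∉ s`, in which `x = 0`.
  have hzero : ∀ δ ∈ insert γ s, (if δ ∈ s then v δ else 0) - (if δ = γ then x else 0) = 0 := by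
    refine hind _ _ (fun δ _ => ?_) ?_
    · refine sub_mem ?_ ?_
      · split_ifs
        · exact h δ (hv δ)
        · exact zero_mem _
      · split_ifs with hδ
        · exact hδ ▸ hx
        · exact zero_mem _
    · rw [Finset.sum_sub_distrib, Finset.sum_ite_mem, Finset.sum_ite_eq',
        if_pos (Finset.mem_insert_self _ _), Finset.inter_eq_right.2 (Finset.subset_insert _ _), sub_self]
  have hγ := hzero γ (Finset.mem_insert_self _ _)
  rw [if_pos rfl, sub_eq_zero] at hγ
  rw [← hγ]
  split_ifs
  · exact hv γ
  · exact zero_mem _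

/-- A homomorphism is determined by its effect on the components of a grading. -/
lemma DualHom.eq_toDualHom (𝓡 : Grading k R Γ) (φ : DualHom e k R Γ)
    (h : ∀ (γ : Γ), ∀ x ∈ 𝓡.comp γ, ∀ χ : DDual Γ,
      φ.toHom χ (x ⊗ₜ[ℤ] 1) = x ⊗ₜ[ℤ] root e (χ.toMu hΓ γ)) :
    φ = 𝓡.toDualHom hR hΓ := by
  refine DualHom.ext (MonoidHom.ext fun χ => AlgEquiv.ext fun y => ?_)
  induction y using 𝓡.ext_induction with
  | zero => simp only [map_zero]
  | add x y hx hy => simp only [map_add, hx, hy]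
  | tmul γ x hx s =>
    rw [Grading.toDualHom_tmul hR hΓ 𝓡 χ hx]
    have hs : x ⊗ₜ[ℤ] s = (1 ⊗ₜ[ℤ] s : ExtRing e k) • (x ⊗ₜ[ℤ] 1 : ExtRing e R) := by
      rw [tmul_smul_tmul, one_smul, mul_one]
    rw [hs]
    refine (map_smul (φ.toHom χ) _ _).trans ?_
    rw [h γ x hx χ, tmul_smul_tmul, one_smul, mul_comm]

/-- Gradings correspond to homomorphisms. -/
noncomputable def gradingEquiv : Grading k R Γ ≃ DualHom e k R Γ where
  toFun 𝓡 := 𝓡.toDualHom hR hΓ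
  invFun φ := φ.toGrading hR hΓ
  left_inv 𝓡 := by
    -- One inclusion of components suffices, so it need only be checked that homogeneous elements
    -- satisfy the eigenvector condition.
    refine (Grading.eq_of_le fun γ x hx χ => ?_).symm
    rw [Grading.toDualHom_tmul hR hΓ 𝓡 χ hx, mul_one]
  right_inv φ := (DualHom.eq_toDualHom hR hΓ (φ.toGrading hR hΓ) φ fun γ x hx χ => hx χ).symm

/-- Both homomorphisms are determined by their values on `x ⊗ 1` with `x` of degree `γ` and `f γ =
δ`, where `(χ ∘ f)(γ) = χ(δ)`. -/
lemma gradingEquiv_map (f : Γ →* Δ) (𝓡 : Grading k R Γ) :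
    gradingEquiv hR hΔ (𝓡.map f) = (gradingEquiv hR hΓ 𝓡).map f := by
  refine (DualHom.eq_toDualHom hR hΔ _ _ fun δ x hx χ => ?_).symm
  change (𝓡.toDualHom hR hΓ).toHom (DDual.map f χ) (x ⊗ₜ[ℤ] 1) = _
  change x ∈ ⨆ γ ∈ f ⁻¹' {δ}, 𝓡.comp γ at hx
  rw [iSup_subtype'] at hx
  induction hx using Submodule.iSup_induction' with
  | mem γ x hx =>
    rw [Grading.toDualHom_tmul hR hΓ 𝓡 _ hx, mul_one]
    have : (DDual.map f χ).toMu hΓ γ = χ.toMu hΔ δ := congrArg (χ.toMu hΔ) γ.2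
    rw [this]
  | zero => rw [TensorProduct.zero_tmul, TensorProduct.zero_tmul, map_zero]
  | add x y _ _ hx hy => rw [TensorProduct.add_tmul, TensorProduct.add_tmul, map_add, hx, hy]

end Iso

/-- The natural isomorphism from gradings to homomorphisms. -/
noncomputable def gradingIso (e : Steinitz) (k : Type u) (R : Type v) [CommRing k] [Ring R]
    [Algebra k R]
    (hR : ∀ d : ℕ+, (Steinitz.ofPNat d).Divides e → Function.Injective fun x : R => (d : ℕ) • x) :
    gradingFunctor.{u, v, w} e k R ≅ dualHomFunctor.{u, v, w} e k R :=
  NatIso.ofComponents (fun Γ => (gradingEquiv hR Γ.property).toIso) fun {Γ Δ} f => by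
    refine ConcreteCategory.hom_ext _ _ fun 𝓡 => ?_
    exact gradingEquiv_map hR Γ.property Δ.property f.hom.hom 𝓡

end TorsionGradings

open TorsionGradings
theorem mainTheorem8 (e : Steinitz) (k : Type u) (R : Type v) [CommRing k] [Ring R] [Algebra k R]
    (hR : ∀ d : ℕ+, (Steinitz.ofPNat d).Divides e →
      Function.Injective fun x : R => (d : ℕ) • x) :
    ∃ Φ : gradingFunctor.{u, v, w} e k R ≅ dualHomFunctor.{u, v, w} e k R,
      ∀ Γ : AbTors.{w} e,
        (∀ (𝓡 : Grading k R Γ.obj) (χ : DDual Γ.obj) (γ : Γ.obj) (x : R), x ∈ 𝓡.comp γ →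
          ((Φ.hom.app Γ : Grading k R Γ.obj → DualHom e k R Γ.obj) 𝓡).toHom χ (x ⊗ₜ[ℤ] 1) =
            x ⊗ₜ[ℤ] root e (χ.eval γ)) ∧
        (∀ (φ : DualHom e k R Γ.obj) (γ : Γ.obj) (x : R),
          x ∈ ((Φ.inv.app Γ : DualHom e k R Γ.obj → Grading k R Γ.obj) φ).comp γ ↔
            ∀ χ : DDual Γ.obj, φ.toHom χ (x ⊗ₜ[ℤ] 1) = x ⊗ₜ[ℤ] root e (χ.eval γ)) := by
  refine ⟨gradingIso e k R hR, fun Γ => ⟨fun 𝓡 χ γ x hx => ?_, fun φ γ x => Iff.rfl⟩⟩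
  exact (Grading.toDualHom_tmul hR Γ.property 𝓡 χ hx 1).trans (by rw [mul_one]; rfl)
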